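/- A (real) Hilbert complex $(W,\mathrm d)$ consists of real Hilbert spaces $W^k$ ($k\in\mathbb Z$) and closed, densely defined linear operators $\mathrm d^k\colon V^k\subset W^k\to V^{k+1}\subset W^{k+1}$ with $\mathrm d^{k+1}\mathrm d^{k}=0$; it is closed if every image $\mathrm d^kV^k$ is closed in $W^{k+1}$. Write $\langle\cdot,\cdot\rangle,\ \|\cdot\|$ for the $W$-inner product and norm and $\|v\|_V^2=\|v\|^2+\|\mathrm dv\|^2$. Let $\mathrm d^*\colon V_k^*\subset W^k\to W^{k-1}$ be the Hilbert-space adjoint of $\mathrm d^{k-1}$, $\mathfrak B^k=\mathrm dV^{k-1}$, $\mathfrak Z^k=\ker\mathrm d^k$, $\mathfrak H^k=\mathfrak Z^k\cap(\mathfrak B^{k})^\perp$, and let $P_{\mathfrak B},P_{\mathfrak H}$ be the $W$-orthogonal projections onto $\mathfrak B^k,\mathfrak H^k$. The complex has the compactness property if, for every $k$, $V^k\cap V^*_k$ is dense in $W^k$ and the inclusion $V^k\cap V^*_k\hookrightarrow W^k$ is compact, where $V^k\cap V_k^*$ carries the norm $(\|v\|^2+\|\mathrm dv\|^2+\|\mathrm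 d^*v\|^2)^{1/2}$. A subcomplex $V_h$ of the domain complex $V$ consists of subspaces $V_h^k\subset V^k$, closed in the $V$-norm, with $\mathrm dV_h^k\subset V_h^{k+1}$; put $\mathfrak H_h^k=\{q\in V_h^k:\mathrm dq=0,\ q\perp\mathrm dV_h^{k-1}\}$. A cochain projection $\pi_h\colon V\to V_h$ consists of idempotent linear maps of $V^k$ onto $V_h^k$ that commute with $\mathrm d$. A family $(\pi_h)$ is uniformly $W$-bounded if for each $k$ there is $M$ with $\|\pi_hv\|\le M\|v\|$ for all $h$ and all $v\in V^k$. Given $F\colon V^k\to W^k$ and $f\in W^k$, the mixed semilinear problem is to find $(\sigma,u,p)\in V^{k-1}\times V^k\times\mathfrak H^k$ with $$\begin{aligned}\langle\sigma,\tau\rangle-\langle u,\mathrm d\tau\rangle&=0 &&\forall\tau\in V^{k-1},\\ \langle\mathrm d\sigma,v\rangle+\langle\mathrm du,\mathrm dv\rangle+\langle p,v\rangle+\langle F(u+p),v\rangle&=\langle f,v\rangle &&\forall v\in V^k,\\ \langle u,q\rangle&=0&&\forall q\in\mathfrak H^k,\end{aligned}$$ and the discrete problem is to find $(\sigma_h,u_h,p_h)\in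 V_h^{k-1}\times V_h^k\times\mathfrak H_h^k$ satisfying the same equations with $V^{k-1},V^k,\mathfrak H^k$ replaced by $V_h^{k-1},V_h^k,\mathfrak H_h^k$. For a closed complex the problem with $F=0$ has a unique solution for each $f$; let $K\colon W^k\to W^k$, $Kf=u$, be its solution operator (for each degree). Define, with operator norms between the $W$-spaces, $$\delta=\|(I-\pi_h)K\|_{\mathcal L(W^k,W^k)},\qquad \mu=\|(I-\pi_h)P_{\mathfrak H}\|_{\mathcal L(W^k,W^k)},$$ $$\eta=\max_{j=0,1}\bigl\{\|(I-\pi_h)\mathrm dK\|_{\mathcal L(W^{k-j},W^{k-j+1})},\ \|(I-\pi_h)\mathrm d^*K\|_{\mathcal L(W^{k+j},W^{k+j-1})}\bigr\},$$ and, for $w\in W^j$, let $E(w)=\inf_{v\in V_h^j}\|w-v\|$. **Theorem.** Let $(V,\mathrm d)$ be the domain complex of a closed Hilbert complex $(W,\mathrm d)$ with the compactness property, and let $(V_h,\mathrm d)$ be a family of subcomplexes, parametrized by $h$, admitting uniformly $W$-bounded cochain projections $\pi_h$. Let $F\colon V^k\to W^k$ be monotone, $\langle Fv-Fv',v-v'\rangle\ge0$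 for all $v,v'\in V^k$, and Lipschitz with respect to the $V$-norm, $\|Fv-Fv'\|\le L\|v-v'\|_V$ for some $L$ and all $v,v'\in V^k$. Then there is a constant $C$, independent of $h$, $f$ and the solutions, such that for every $h$, every $f\in W^k$, every solution $(\sigma,u,p)$ of the mixed semilinear problem and every solution $(\sigma_h,u_h,p_h)$ of the discrete problem, $$\begin{aligned} \|\mathrm d(\sigma-\sigma_h)\|&\le C\bigl[E(\mathrm d\sigma)+E(u)+E(\mathrm du)+E(p)+\eta E(\sigma)+\mu E(P_{\mathfrak B}u)\bigr],\\ \|\sigma-\sigma_h\|&\le C\bigl[E(\sigma)+E(u)+E(\mathrm du)+E(p)+(\eta+\delta+\mu)E(\mathrm d\sigma)+\mu E(P_{\mathfrak B}u)\bigr],\\ \|u-u_h\|_V+\|p-p_h\|&\le C\bigl[E(u)+E(\mathrm du)+E(p)+\eta\,[E(\sigma)+E(\mathrm d\sigma)]+(\delta+\mu)E(\mathrm d\sigma)+\mu E(P_{\mathfrak B}u)\bigr]. \end{aligned}$$ -/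

import Mathlib

open scoped InnerProductSpace

noncomputable section

universe w

/-- A (real) Hilbert complex on the sequence of Hilbert spaces `W k`, `k ∈ ℤ`: dense domains `V k`
and closed linear operators `d : V k ⊂ W k → V (k + 1) ⊂ W (k + 1)` with `d ∘ d = 0`. The
differential `V i → W j` is indexed by both degrees together with a proof of `i + 1 = j`. -/
structure HilbertComplex (W : ℤ → Type w) [∀ k, NormedAddCommGroup (W k)]
    [∀ k, InnerProductSpace ℝ (W k)] [∀ k, CompleteSpace (W k)] where
  V : ∀ k, Submodule ℝ (W k)
  d : ∀ i j : ℤ, i + 1 = j → (V i →ₗ[ℝ] W j)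
  dense_V : ∀ k, Dense (V k : Set (W k))
  closed_d : ∀ (i j : ℤ) (h : i + 1 = j),
    IsClosed {x : W i × W j | ∃ v : V i, x = ((v : W i), d i j h v)}
  d_mem : ∀ (i j : ℤ) (h : i + 1 = j) (v : V i), d i j h v ∈ V j
  d_comp_d : ∀ (i j l : ℤ) (h : i + 1 = j) (h' : j + 1 = l) (v : V i),
    d j l h' ⟨d i j h v, d_mem i j h v⟩ = 0

/-- The operator norm `inf {c ≥ 0 | ‖T x‖ ≤ c ‖x‖ for all x}` of a map between normed spaces. -/
def operatorNorm {X Y : Type*} [NormedAddCommGroup X] [NormedAddCommGroup Y] (T : X → Y) : ℝ :=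
  sInf {c : ℝ | 0 ≤ c ∧ ∀ x, ‖T x‖ ≤ c * ‖x‖}

namespace HilbertComplex

variable {W : ℤ → Type w} [∀ k, NormedAddCommGroup (W k)] [∀ k, InnerProductSpace ℝ (W k)]
  [∀ k, CompleteSpace (W k)] (C : HilbertComplex W)

/-- The differential as a map `V i → V j` of the domain complex. -/
def dV (i j : ℤ) (h : i + 1 = j) : C.V i →ₗ[ℝ] C.V j :=
  (C.d i j h).codRestrict (C.V j) (C.d_mem i j h)

/-- The differential `V k → V (k + 1)`. -/
abbrev dNext (k : ℤ) : C.V k →ₗ[ℝ] C.V (k + 1) := C.dV k (k + 1) rfl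

/-- The differential `V (k - 1) → V k`. -/
abbrev dPrev (k : ℤ) : C.V (k - 1) →ₗ[ℝ] C.V k := C.dV (k - 1) k (sub_add_cancel k 1)

/-- The graph norm `‖v‖_V = (‖v‖² + ‖d v‖²)^(1/2)` of the domain complex. -/
def normV {k : ℤ} (v : C.V k) : ℝ := Real.sqrt (‖v‖ ^ 2 + ‖C.dNext k v‖ ^ 2)

/-- The complex is closed: all images `d (V k)` are closed in `W (k + 1)`. -/
def IsClosedComplex : Prop :=
  ∀ k : ℤ, IsClosed (Set.range fun v : C.V k => C.d k (k + 1) rfl v)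

/-- The Hilbert-space adjoint `d* : V*_k ⊂ W k → W (k - 1)` of `d : V (k - 1) ⊂ W (k - 1) → W k`. -/
def dStar (k : ℤ) : W k →ₗ.[ℝ] W (k - 1) :=
  LinearPMap.adjoint (⟨C.V (k - 1), C.d (k - 1) k (sub_add_cancel k 1)⟩ : W (k - 1) →ₗ.[ℝ] W k)

/-- The compactness property: for all `k`, `V k ∩ V*_k` is dense in `W k` and its inclusion into
`W k` is compact, i.e. its unit ball for the norm `(‖w‖² + ‖d w‖² + ‖d* w‖²)^(1/2)` is relatively
compact in `W k`. -/
def CompactnessProperty : Prop :=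
  ∀ k : ℤ, Dense {x : W k | x ∈ C.V k ∧ x ∈ (C.dStar k).domain} ∧
    IsCompact (closure {x : W k | ∃ (hx : x ∈ C.V k) (hx' : x ∈ (C.dStar k).domain),
      ‖x‖ ^ 2 + ‖C.dNext k ⟨x, hx⟩‖ ^ 2 + ‖C.dStar k ⟨x, hx'⟩‖ ^ 2 ≤ 1})

/-- A Hilbert subcomplex `S ⊂ V` of the domain complex: subspaces of the `V k`, mapped into each
other by `d`, and closed in the graph norm. -/
structure Subcomplex where
  space : ∀ k, Submodule ℝ (W k)
  le_V : ∀ k, space k ≤ C.V k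
  d_mem_space : ∀ (i j : ℤ) (h : i + 1 = j) (v : C.V i), (v : W i) ∈ space i →
    C.d i j h v ∈ space j
  closed_space : ∀ (i j : ℤ) (h : i + 1 = j),
    IsClosed {x : W i × W j | ∃ v : C.V i, (v : W i) ∈ space i ∧ x = ((v : W i), C.d i j h v)}

/-- The domain complex as a subcomplex of itself. -/
def full : C.Subcomplex where
  space := C.V
  le_V _ := le_rfl
  d_mem_space i j h v _ := C.d_mem i j h v
  closed_space i j h := by
    have := C.closed_d i j h
    convert this using 5 with x v
    simp

variable {C}

namespace Subcomplex

variable (S : C.Subcomplex)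

/-- The cocycles `{v ∈ S k | d v = 0}`. -/
def cocycles (k : ℤ) : Submodule ℝ (W k) :=
  S.space k ⊓ (LinearMap.ker (C.dNext k)).map (C.V k).subtype

/-- The coboundaries `d (S (k - 1))`. -/
def coboundaries (k : ℤ) : Submodule ℝ (W k) :=
  ((S.space (k - 1)).comap (C.V (k - 1)).subtype).map (C.d (k - 1) k (sub_add_cancel k 1))

/-- The harmonic space: the cocycles that are `W`-orthogonal to the coboundaries. For
`S = C.full` it is `ℌ^k`, for a subcomplex `V_h` it is `ℌ_h^k`. -/
def harmonic (k : ℤ) : Submodule ℝ (W k) := S.cocycles k ⊓ (S.coboundaries k)ᗮ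

theorem isClosed_cocycles (k : ℤ) : IsClosed (S.cocycles k : Set (W k)) := by
  have h := (S.closed_space k (k + 1) rfl).preimage
    (Continuous.prodMk (continuous_id (X := W k)) (continuous_const (y := (0 : W (k + 1)))))
  convert h using 1
  ext x
  simp only [cocycles, Submodule.coe_inf, Set.mem_inter_iff, SetLike.mem_coe, Submodule.mem_map,
    LinearMap.mem_ker, Set.mem_preimage, Set.mem_ofPred_eq, Prod.mk.injEq, id]
  constructor
  · rintro ⟨hx, v, hv, rfl⟩
    exact ⟨v, hx, rfl, (congrArg Subtype.val hv).symm⟩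
  · rintro ⟨v, hv, rfl, h0⟩
    exact ⟨hv, v, Subtype.ext h0.symm, rfl⟩

theorem isClosed_harmonic (k : ℤ) : IsClosed (S.harmonic k : Set (W k)) :=
  (S.isClosed_cocycles k).inter (Submodule.isClosed_orthogonal _)

instance (k : ℤ) : CompleteSpace (S.harmonic k) :=
  (S.isClosed_harmonic k).completeSpace_coe

theorem harmonic_le_V (k : ℤ) : S.harmonic k ≤ C.V k :=
  fun _ hx => S.le_V k hx.1.1

/-- `(σ, u, p) ∈ S (k - 1) × S k × ℌ_S^k` solves the mixed semilinear problem on `S`: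
`⟨σ, τ⟩ - ⟨u, dτ⟩ = 0` for `τ ∈ S (k - 1)`,
`⟨dσ, v⟩ + ⟨du, dv⟩ + ⟨p, v⟩ + ⟨F (u + p), v⟩ = ⟨f, v⟩` for `v ∈ S k`,
`⟨u, q⟩ = 0` for `q ∈ ℌ_S^k`. -/
structure IsMixedSolution (k : ℤ) (F : C.V k → W k) (f : W k)
    (σ : C.V (k - 1)) (u p : C.V k) : Prop where
  σ_mem : (σ : W (k - 1)) ∈ S.space (k - 1)
  u_mem : (u : W k) ∈ S.space k
  p_mem : (p : W k) ∈ S.harmonic k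
  eq_one : ∀ τ : C.V (k - 1), (τ : W (k - 1)) ∈ S.space (k - 1) →
    ⟪(σ : W (k - 1)), (τ : W (k - 1))⟫_ℝ - ⟪(u : W k), (C.dPrev k τ : W k)⟫_ℝ = 0
  eq_two : ∀ v : C.V k, (v : W k) ∈ S.space k →
    ⟪(C.dPrev k σ : W k), (v : W k)⟫_ℝ
      + ⟪(C.dNext k u : W (k + 1)), (C.dNext k v : W (k + 1))⟫_ℝ
      + ⟪(p : W k), (v : W k)⟫_ℝ + ⟪F (u + p), (v : W k)⟫_ℝ = ⟪f, (v : W k)⟫_ℝ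
  eq_three : ∀ q ∈ S.harmonic k, ⟪(u : W k), q⟫_ℝ = 0

/-- The error `E(w)` of best approximation of `w ∈ W k` from `S k` in the norm of `W k`. -/
def bestError {k : ℤ} (w : W k) : ℝ := ⨅ v : S.space k, ‖w - (v : W k)‖

/-- A cochain projection `π : V → S`: linear maps `V k → S k` that commute with `d` and are
idempotent and onto `S k`, i.e. fix `S k` pointwise. -/
structure CochainProjection where
  map : ∀ k, C.V k →ₗ[ℝ] C.V k
  map_mem : ∀ k (v : C.V k), (map k v : W k) ∈ S.space k
  map_fix : ∀ k (v : C.V k), (v : W k) ∈ S.space k → map k v = v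
  map_d : ∀ (i j : ℤ) (h : i + 1 = j) (v : C.V i), map j (C.dV i j h v) = C.dV i j h (map i v)

end Subcomplex

variable (C)

/-- The solution `(σ, u, p)` of the mixed linear problem (`F = 0`) with right-hand side `f`; it
exists and is unique when the complex is closed. -/
def linearSolution (k : ℤ) (f : W k) : C.V (k - 1) × C.V k × C.V k :=
  Classical.epsilon fun s => C.full.IsMixedSolution k (fun _ => 0) f s.1 s.2.1 s.2.2

/-- The solution operator `K f = u` of the mixed linear problem. -/
def K (k : ℤ) (f : W k) : C.V k := (C.linearSolution k f).2.1

/-- The operator `d* K`, as the component `σ = d* u` of the solution of the mixed linear problem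
(see `dStar_eq_of_isMixedSolution`). -/
def dStarK (k : ℤ) (f : W k) : C.V (k - 1) := (C.linearSolution k f).1

variable {C} in
/-- In a solution of the mixed problem, `u` lies in the domain of `d*`, and `d* u = σ`. -/
theorem dStar_eq_of_isMixedSolution {k : ℤ} {F : C.V k → W k} {f : W k} {σ : C.V (k - 1)}
    {u p : C.V k} (h : C.full.IsMixedSolution k F f σ u p) :
    ∃ hu : (u : W k) ∈ (C.dStar k).domain, C.dStar k ⟨u, hu⟩ = (σ : W (k - 1)) := by
  have key : ∀ x : C.V (k - 1), ⟪(σ : W (k - 1)), (x : W (k - 1))⟫_ℝ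
      = ⟪(u : W k), C.d (k - 1) k (sub_add_cancel k 1) x⟫_ℝ :=
    fun x => sub_eq_zero.1 (h.eq_one x x.2)
  refine ⟨LinearPMap.mem_adjoint_domain_of_exists _ ⟨σ, key⟩, ?_⟩
  exact LinearPMap.adjoint_apply_eq (C.dense_V (k - 1)) _ key

/-- The orthogonal projection `P_𝔅` onto the coboundaries `𝔅^k = d (V (k - 1))`, which are equal to
their closure when the complex is closed. -/
def projB (k : ℤ) : W k →L[ℝ] W k := (C.full.coboundaries k).topologicalClosure.starProjection

/-- The orthogonal projection `P_ℌ` of `W k` onto the harmonic space, as a map into `V k`. -/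
def projH (k : ℤ) (w : W k) : C.V k :=
  ⟨(C.full.harmonic k).starProjection w,
    C.full.harmonic_le_V k (Submodule.starProjection_apply_mem _ w)⟩

namespace Subcomplex.CochainProjection

variable {C} {S : C.Subcomplex} (π : S.CochainProjection)

/-- `δ = ‖(I - π) K‖` as an operator `W k → W k`. -/
def delta (k : ℤ) : ℝ :=
  operatorNorm fun f : W k => C.K k f - π.map k (C.K k f)

/-- `μ = ‖(I - π) P_ℌ‖` as an operator `W k → W k`. -/
def mu (k : ℤ) : ℝ :=
  operatorNorm fun f : W k => C.projH k f - π.map k (C.projH k f)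

/-- `‖(I - π) d K‖` as an operator `W k → W (k + 1)`. -/
def normDK (k : ℤ) : ℝ :=
  operatorNorm fun f : W k => C.dNext k (C.K k f) - π.map (k + 1) (C.dNext k (C.K k f))

/-- `‖(I - π) d* K‖` as an operator `W k → W (k - 1)`. -/
def normDStarK (k : ℤ) : ℝ :=
  operatorNorm fun f : W k => C.dStarK k f - π.map (k - 1) (C.dStarK k f)

/-- `η = max_{j = 0, 1} {‖(I - π) d K‖_{W (k - j) → W (k - j + 1)},
‖(I - π) d* K‖_{W (k + j) → W (k + j - 1)}}`. -/
def eta (k : ℤ) : ℝ :=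
  max (max (π.normDK k) (π.normDStarK k)) (max (π.normDK (k - 1)) (π.normDStarK (k + 1)))

end Subcomplex.CochainProjection

end HilbertComplex

end

/-!
The error is measured against an auxiliary object, the discrete solution `(σ', u', p')` of the
*linear* mixed problem with right-hand side `f - F (u + p)`; the exact solution `(σ, u, p)` solves
that linear problem on the full complex.

**The linear problem.** When the coboundaries are closed, the bounded inverse theorem provides a
pseudoinverse of each differential (`exists_isPseudoinverse`). With `G` and `D` the pseudoinverses
of the differentials into and out of degree `k`, the solution of the linear problem is `σ = G f`,
`u = G* G f + D D* f`, and `p` is the harmonic part of `f`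
(`isMixedSolution_of_isPseudoinverse`). Hence `d* K = G`, `d K = D*` and `K = G* G + D D*`, so that
`η` bounds `I - π` on the ranges of `G`, `G*`, `D`, and `δ` bounds it on `G* G b` for coboundaries
`b`. The coboundaries of a subcomplex with a cochain projection are the coboundaries of the full
complex among its cocycles, hence closed, and the same existence result applies to them.

**The error of the linear method.** The element `d σ'` is the orthogonal projection of `d σ` onto
the discrete coboundaries, so `d (σ - σ')` is orthogonal to the range of `π` over the coboundaries
(`norm_dσ_sub_le`). By duality `G (d (σ - σ'))` then gains a factor `η` (`norm_G_le`), which gives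
the estimate for `σ - σ'`, and its pairing with `G b` gains a factor `δ` (`inner_G_G_le`). A
discrete harmonic element `q` has a coboundary part of norm at most `μ ‖q‖`
(`exists_harmonic_gap`), which gives the estimate for `p - p'`. For `d (u - u')` the error equation
is tested with discrete elements `v` orthogonal to the discrete cocycles; these differ from
`D (d v)`, which the cocycle `d (σ - σ') + p - p'` does not see, by at most `η ‖d v‖`. Finally
`π u - u'` is split by the discrete Hodge decomposition and the three parts are estimated
separately (`norm_u_sub_le`).

**The semilinear problem.** The difference of `(σ', u', p')` and `(σh, uh, ph)` solves a discrete
linear problem with right-hand side `F (uh + ph) - F (u + p)`. In its energy identity,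
monotonicity discards `F (uh + ph) - F (u' + p')`, and the Lipschitz condition together with the
discrete stability of `u` bounds the rest by the error of the linear method
(`norm_sub_semilinear_le`).

All constants depend only on the pseudoinverses of the full complex, on the bounds for `π` in the
degrees `k - 1`, `k`, `k + 1`, and on the Lipschitz constant of `F`.
-/

open scoped InnerProductSpace

universe w

/-! ### Cocycles, coboundaries and the Hodge decomposition of a subcomplex -/

namespace HilbertComplex

variable {W : ℤ → Type w} [∀ k, NormedAddCommGroup (W k)] [∀ k, InnerProductSpace ℝ (W k)]
  [∀ k, CompleteSpace (W k)] {C : HilbertComplex W}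

namespace Subcomplex

variable (S : C.Subcomplex)

theorem coe_mem_cocycles_iff {i j : ℤ} (h : i + 1 = j) (v : C.V i) :
    (v : W i) ∈ S.cocycles i ↔ (v : W i) ∈ S.space i ∧ C.d i j h v = 0 := by
  subst h
  simp only [cocycles, Submodule.mem_inf, Submodule.mem_map, LinearMap.mem_ker,
    Submodule.subtype_apply, Subtype.coe_inj, exists_eq_right]
  exact and_congr_right fun _ => ⟨fun h0 => congrArg Subtype.val h0, fun h0 => Subtype.ext h0⟩

theorem mem_coboundaries_iff {i j : ℤ} (h : i + 1 = j) (x : W j) :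
    x ∈ S.coboundaries j ↔ ∃ v : C.V i, (v : W i) ∈ S.space i ∧ C.d i j h v = x := by
  obtain rfl : i = j - 1 := by omega
  simp [coboundaries]

variable {S}

theorem d_mem_coboundaries {i j : ℤ} (h : i + 1 = j) {v : C.V i} (hv : (v : W i) ∈ S.space i) :
    C.d i j h v ∈ S.coboundaries j :=
  (S.mem_coboundaries_iff h _).2 ⟨v, hv, rfl⟩

theorem d_eq_zero_of_mem_cocycles {i j : ℤ} (h : i + 1 = j) {v : C.V i}
    (hv : (v : W i) ∈ S.cocycles i) : C.d i j h v = 0 :=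
  ((S.coe_mem_cocycles_iff h v).1 hv).2

variable (S)

theorem coboundaries_le_cocycles (j : ℤ) : S.coboundaries j ≤ S.cocycles j := by
  intro x hx
  obtain ⟨v, hv, rfl⟩ := (S.mem_coboundaries_iff (sub_add_cancel j 1) x).1 hx
  exact (S.coe_mem_cocycles_iff rfl ⟨_, C.d_mem _ _ _ v⟩).2
    ⟨S.d_mem_space _ _ _ v hv, C.d_comp_d _ _ _ _ rfl v⟩

theorem cocycles_le_full (j : ℤ) : S.cocycles j ≤ C.full.cocycles j :=
  fun _ hx => ⟨S.le_V j hx.1, hx.2⟩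

theorem coboundaries_le_full (j : ℤ) : S.coboundaries j ≤ C.full.coboundaries j := by
  intro x hx
  obtain ⟨v, hv, rfl⟩ := (S.mem_coboundaries_iff (sub_add_cancel j 1) x).1 hx
  exact d_mem_coboundaries _ v.2

theorem isClosed_coboundaries_full (hC : C.IsClosedComplex) (j : ℤ) :
    IsClosed (C.full.coboundaries j : Set (W j)) := by
  obtain ⟨i, rfl⟩ : ∃ i, j = i + 1 := ⟨j - 1, by omega⟩
  convert hC i using 1
  ext x
  rw [SetLike.mem_coe, C.full.mem_coboundaries_iff rfl]
  exact ⟨fun ⟨v, _, hv⟩ => ⟨v, hv⟩, fun ⟨v, hv⟩ => ⟨v, v.2, hv⟩⟩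

/-- A coboundary `d v` of the domain complex that lies in `S` is `π (d v) = d (π v)`, hence a
coboundary of `S`. -/
theorem coboundaries_eq_inf {S : C.Subcomplex} (π : S.CochainProjection) (j : ℤ) :
    S.coboundaries j = C.full.coboundaries j ⊓ S.cocycles j := by
  refine le_antisymm (le_inf (S.coboundaries_le_full j) (S.coboundaries_le_cocycles j)) ?_
  rintro x ⟨hx, hx'⟩
  obtain ⟨v, -, rfl⟩ := (C.full.mem_coboundaries_iff (sub_add_cancel j 1) x).1 hx
  have h1 := π.map_fix j (C.dV _ j (sub_add_cancel j 1) v) hx'.1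
  rw [π.map_d] at h1
  have h2 := congrArg Subtype.val h1
  refine (S.mem_coboundaries_iff (sub_add_cancel j 1) _).2 ⟨_, π.map_mem _ v, h2⟩

theorem isClosed_coboundaries {S : C.Subcomplex} (hC : C.IsClosedComplex)
    (π : S.CochainProjection) (j : ℤ) : IsClosed (S.coboundaries j : Set (W j)) := by
  rw [coboundaries_eq_inf π]
  exact (isClosed_coboundaries_full hC j).inter (S.isClosed_cocycles j)

instance (k : ℤ) : CompleteSpace (S.cocycles k) := (S.isClosed_cocycles k).completeSpace_coe

/-- The Hodge decomposition of the cocycles: a cocycle is the sum of a coboundary and a harmonic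
element. -/
theorem exists_add_of_mem_cocycles {k : ℤ} (hB : IsClosed (S.coboundaries k : Set (W k)))
    {x : W k} (hx : x ∈ S.cocycles k) :
    ∃ b ∈ S.coboundaries k, ∃ q ∈ S.harmonic k, x = b + q := by
  have : CompleteSpace (S.coboundaries k) := hB.completeSpace_coe
  refine ⟨(S.coboundaries k).starProjection x, Submodule.starProjection_apply_mem _ x,
    x - (S.coboundaries k).starProjection x, ⟨?_, ?_⟩, by abel⟩
  · exact sub_mem hx (S.coboundaries_le_cocycles k (Submodule.starProjection_apply_mem _ x))
  · exact Submodule.sub_starProjection_mem_orthogonal x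

/-- Subtracting the projection onto the cocycles makes an element of `S` orthogonal to them, and
does not change its differential. -/
theorem exists_orthogonal_cocycles {i j : ℤ} (h : i + 1 = j) {x : C.V i}
    (hx : (x : W i) ∈ S.space i) :
    ∃ v : C.V i, (v : W i) ∈ S.space i ∧ (v : W i) ∈ (S.cocycles i)ᗮ ∧
      (x : W i) - v ∈ S.cocycles i ∧ C.d i j h v = C.d i j h x := by
  have hz := Submodule.starProjection_apply_mem (S.cocycles i) (x : W i)
  let z : C.V i := ⟨(S.cocycles i).starProjection (x : W i), S.le_V i hz.1⟩
  have hdz : C.d i j h z = 0 := d_eq_zero_of_mem_cocycles h hz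
  refine ⟨x - z, sub_mem hx hz.1, Submodule.sub_starProjection_mem_orthogonal _, ?_, ?_⟩
  · rwa [AddSubgroupClass.coe_sub, sub_sub_cancel]
  · rw [map_sub, hdz, sub_zero]

/-! ### Pseudoinverses of the differentials -/

/-- `G` is the pseudoinverse of `d : S i → W j`: it maps `y ∈ W j` to the element `v` of `S i`
orthogonal to the cocycles for which `d v` is the orthogonal projection of `y` onto the
coboundaries `d (S i)`. -/
structure IsPseudoinverse (i j : ℤ) (h : i + 1 = j) (G : W j →L[ℝ] W i) : Prop where
  mem : ∀ y, G y ∈ S.space i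
  orthogonal : ∀ y, ∀ z ∈ S.cocycles i, ⟪G y, z⟫_ℝ = 0
  inner_d : ∀ (y : W j) (hy : G y ∈ C.V i), ∀ b ∈ S.coboundaries j,
    ⟪C.d i j h ⟨G y, hy⟩, b⟫_ℝ = ⟪y, b⟫_ℝ

/-- The graph of `d : S i → W j`, restricted to the arguments orthogonal to the cocycles. -/
def reducedGraph (i j : ℤ) (h : i + 1 = j) : Submodule ℝ (W i × W j) where
  carrier := {x | (∃ v : C.V i, (v : W i) ∈ S.space i ∧ x = ((v : W i), C.d i j h v)) ∧
    x.1 ∈ (S.cocycles i)ᗮ}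
  zero_mem' := ⟨⟨0, zero_mem _, by simp; rfl⟩, zero_mem _⟩
  add_mem' := by
    rintro _ _ ⟨⟨v, hv, rfl⟩, hv'⟩ ⟨⟨v₂, hv₂, rfl⟩, hv₂'⟩
    exact ⟨⟨v + v₂, add_mem hv hv₂, by simp⟩, add_mem hv' hv₂'⟩
  smul_mem' := by
    rintro c _ ⟨⟨v, hv, rfl⟩, hv'⟩
    exact ⟨⟨c • v, Submodule.smul_mem _ c hv, by simp⟩, Submodule.smul_mem _ c hv'⟩

theorem isClosed_reducedGraph (i j : ℤ) (h : i + 1 = j) :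
    IsClosed (S.reducedGraph i j h : Set (W i × W j)) :=
  (S.closed_space i j h).inter ((Submodule.isClosed_orthogonal _).preimage continuous_fst)

/-- The bounded inverse theorem, applied to the projection of the reduced graph onto the
coboundaries. -/
theorem exists_isPseudoinverse {i j : ℤ} (h : i + 1 = j)
    (hB : IsClosed (S.coboundaries j : Set (W j))) :
    ∃ G : W j →L[ℝ] W i, S.IsPseudoinverse i j h G := by
  have : CompleteSpace (S.coboundaries j) := hB.completeSpace_coe
  have : CompleteSpace (S.reducedGraph i j h) :=
    (S.isClosed_reducedGraph i j h).completeSpace_coe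
  let T : S.reducedGraph i j h →L[ℝ] S.coboundaries j :=
    ((ContinuousLinearMap.snd ℝ (W i) (W j)).comp (S.reducedGraph i j h).subtypeL).codRestrict
      (S.coboundaries j) (by
        rintro ⟨_, ⟨v, hv, rfl⟩, -⟩
        exact d_mem_coboundaries h hv)
  have hker : LinearMap.ker (T : S.reducedGraph i j h →ₗ[ℝ] S.coboundaries j) = ⊥ := by
    rw [LinearMap.ker_eq_bot']
    rintro ⟨_, ⟨v, hv, rfl⟩, hv'⟩ h0
    have h0 : C.d i j h v = 0 := congrArg Subtype.val h0
    have : (v : W i) = 0 := by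
      have := hv' v ((S.coe_mem_cocycles_iff h v).2 ⟨hv, h0⟩)
      simpa using this
    simp [h0, this]
  have hrange : LinearMap.range (T : S.reducedGraph i j h →ₗ[ℝ] S.coboundaries j) = ⊤ := by
    rw [LinearMap.range_eq_top]
    rintro ⟨b, hb⟩
    obtain ⟨v, hv, rfl⟩ := (S.mem_coboundaries_iff h b).1 hb
    obtain ⟨w, hw, hw', -, hdw⟩ := S.exists_orthogonal_cocycles h hv
    exact ⟨⟨((w : W i), C.d i j h w), ⟨w, hw, rfl⟩, hw'⟩, Subtype.ext hdw⟩
  let e := ContinuousLinearEquiv.ofBijective T hker hrange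
  let R : W j →L[ℝ] S.reducedGraph i j h :=
    (e.symm : S.coboundaries j →L[ℝ] S.reducedGraph i j h).comp
      (S.coboundaries j).orthogonalProjectionOnto
  have hR : ∀ y, ((R y).1.2 : W j) = (S.coboundaries j).starProjection y := fun y =>
    congrArg Subtype.val (e.apply_symm_apply ((S.coboundaries j).orthogonalProjectionOnto y))
  refine ⟨(ContinuousLinearMap.fst ℝ (W i) (W j)).comp
    ((S.reducedGraph i j h).subtypeL.comp R), ?_, ?_, ?_⟩
  · intro y
    obtain ⟨⟨v, hv, hv'⟩, -⟩ := (R y).2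
    change (R y).1.1 ∈ _
    rwa [hv']
  · intro y z hz
    rw [real_inner_comm]
    exact (R y).2.2 z hz
  · intro y hy b hb
    obtain ⟨⟨v, hv, hv'⟩, -⟩ := (R y).2
    have h1 : (⟨(R y).1.1, hy⟩ : C.V i) = v := Subtype.ext (congrArg Prod.fst hv')
    have h2 : C.d i j h v = (S.coboundaries j).starProjection y := by rw [← hR y, hv']
    change ⟪C.d i j h ⟨(R y).1.1, hy⟩, b⟫_ℝ = _
    rw [h1, h2, ← sub_eq_zero, ← inner_sub_left, ← neg_sub, inner_neg_left, neg_eq_zero]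
    exact (Submodule.mem_orthogonal' _ _).1
      (Submodule.sub_starProjection_mem_orthogonal (K := S.coboundaries j) y) b hb

namespace IsPseudoinverse

variable {S} {i j : ℤ} {h : i + 1 = j} {G : W j →L[ℝ] W i} (hG : S.IsPseudoinverse i j h G)

include hG

theorem mem_V (y : W j) : G y ∈ C.V i := S.le_V i (hG.mem y)

theorem d_mem (y : W j) : C.d i j h ⟨G y, hG.mem_V y⟩ ∈ S.coboundaries j :=
  d_mem_coboundaries h (hG.mem y)

theorem eq_of_inner_d {v : C.V i} (hv : (v : W i) ∈ S.space i)
    (hv' : ∀ z ∈ S.cocycles i, ⟪(v : W i), z⟫_ℝ = 0) {y : W j}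
    (hy : ∀ b ∈ S.coboundaries j, ⟪C.d i j h v, b⟫_ℝ = ⟪y, b⟫_ℝ) : (v : W i) = G y := by
  let w : C.V i := v - ⟨G y, hG.mem_V y⟩
  have hw : (w : W i) ∈ S.space i := sub_mem hv (hG.mem y)
  have hdw : C.d i j h w = 0 := by
    have hb := d_mem_coboundaries h hw
    have key : ⟪C.d i j h v - C.d i j h ⟨G y, hG.mem_V y⟩, C.d i j h w⟫_ℝ = 0 := by
      rw [inner_sub_left, hy _ hb, hG.inner_d _ _ _ hb, sub_self]
    rwa [← map_sub, inner_self_eq_zero] at key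
  have hwz := (S.coe_mem_cocycles_iff h w).2 ⟨hw, hdw⟩
  have hw0 : (w : W i) = 0 := by
    have key : ⟪(v : W i) - G y, (w : W i)⟫_ℝ = 0 := by
      rw [inner_sub_left, hv' _ hwz, hG.orthogonal _ _ hwz, sub_self]
    exact inner_self_eq_zero.1 key
  exact sub_eq_zero.1 hw0

theorem d_apply {b : W j} (hb : b ∈ S.coboundaries j) :
    C.d i j h ⟨G b, hG.mem_V b⟩ = b := by
  have hb' := sub_mem (hG.d_mem b) hb
  rw [← sub_eq_zero, ← inner_self_eq_zero (𝕜 := ℝ)]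
  nth_rewrite 1 [inner_sub_left]
  rw [hG.inner_d _ _ _ hb', sub_self]

theorem sub_mem_cocycles {v : C.V i} (hv : (v : W i) ∈ S.space i) :
    (v : W i) - G (C.d i j h v) ∈ S.cocycles i := by
  refine (S.coe_mem_cocycles_iff h (v - ⟨_, hG.mem_V (C.d i j h v)⟩)).2
    ⟨sub_mem hv (hG.mem _), ?_⟩
  rw [map_sub, hG.d_apply (d_mem_coboundaries h hv), sub_self]

theorem apply_d {v : C.V i} (hv : (v : W i) ∈ S.space i)
    (hv' : ∀ z ∈ S.cocycles i, ⟪(v : W i), z⟫_ℝ = 0) : G (C.d i j h v) = v :=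
  (hG.eq_of_inner_d hv hv' fun _ _ => rfl).symm

theorem apply_eq_zero {y : W j} (hy : ∀ b ∈ S.coboundaries j, ⟪y, b⟫_ℝ = 0) : G y = 0 :=
  (hG.eq_of_inner_d (v := 0) (zero_mem _) (fun z _ => inner_zero_left z)
    fun b hb => by simp [hy b hb]).symm

theorem adjoint_apply_eq_zero {z : W i} (hz : z ∈ S.cocycles i) :
    ContinuousLinearMap.adjoint G z = 0 := by
  rw [← inner_self_eq_zero (𝕜 := ℝ), ContinuousLinearMap.adjoint_inner_left, real_inner_comm]
  exact hG.orthogonal _ _ hz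

theorem adjoint_mem (hB : IsClosed (S.coboundaries j : Set (W j))) (x : W i) :
    ContinuousLinearMap.adjoint G x ∈ S.coboundaries j := by
  have : CompleteSpace (S.coboundaries j) := hB.completeSpace_coe
  rw [← Submodule.orthogonal_orthogonal (S.coboundaries j), Submodule.mem_orthogonal']
  intro y hy
  rw [ContinuousLinearMap.adjoint_inner_left,
    hG.apply_eq_zero ((Submodule.mem_orthogonal' _ _).1 hy), inner_zero_right]

end IsPseudoinverse

/-! ### Existence of solutions of the linear problem -/

/-- The solution of the linear mixed problem in terms of the pseudoinverses `G` and `D` of the two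
differentials: `σ = G f`, `u = G* G f + D D* f`, and `p` is the harmonic part of `f`. -/
theorem isMixedSolution_of_isPseudoinverse {k : ℤ} {G : W k →L[ℝ] W (k - 1)}
    {D : W (k + 1) →L[ℝ] W k} (hG : S.IsPseudoinverse (k - 1) k (sub_add_cancel k 1) G)
    (hD : S.IsPseudoinverse k (k + 1) rfl D)
    (hB : IsClosed (S.coboundaries k : Set (W k))) (f : W k) :
    S.IsMixedSolution k (fun _ => 0) f ⟨G f, hG.mem_V f⟩
      (⟨ContinuousLinearMap.adjoint G (G f),
          S.le_V k (S.coboundaries_le_cocycles k (hG.adjoint_mem hB _)).1⟩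
        + ⟨D (ContinuousLinearMap.adjoint D f), hD.mem_V _⟩)
      ⟨(S.harmonic k).starProjection f,
        S.harmonic_le_V k (Submodule.starProjection_apply_mem _ f)⟩ where
  σ_mem := hG.mem f
  u_mem := add_mem (S.coboundaries_le_cocycles k (hG.adjoint_mem hB _)).1 (hD.mem _)
  p_mem := Submodule.starProjection_apply_mem _ f
  eq_one := by
    intro τ hτ
    have hdτ := d_mem_coboundaries (sub_add_cancel k 1) hτ
    change ⟪G f, (τ : W (k - 1))⟫_ℝ - ⟪ContinuousLinearMap.adjoint G (G f)
      + D (ContinuousLinearMap.adjoint D f), C.d (k - 1) k (sub_add_cancel k 1) τ⟫_ℝ = 0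
    rw [inner_add_left, hD.orthogonal _ _ (S.coboundaries_le_cocycles k hdτ),
      ContinuousLinearMap.adjoint_inner_left, add_zero, ← inner_sub_right]
    exact hG.orthogonal _ _ (hG.sub_mem_cocycles hτ)
  eq_two := by
    intro v hv
    have hdv := d_mem_coboundaries (rfl : k + 1 = k + 1) hv
    have hA := hG.adjoint_mem hB (G f)
    have hdA : C.d k (k + 1) rfl ⟨ContinuousLinearMap.adjoint G (G f),
        S.le_V k (S.coboundaries_le_cocycles k hA).1⟩ = 0 :=
      d_eq_zero_of_mem_cocycles rfl (S.coboundaries_le_cocycles k hA)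
    have hσ := hG.d_mem f
    have hp := Submodule.starProjection_apply_mem (S.harmonic k) f
    change ⟪C.d (k - 1) k (sub_add_cancel k 1) ⟨G f, hG.mem_V f⟩, (v : W k)⟫_ℝ
      + ⟪C.d k (k + 1) rfl (_ + _), C.d k (k + 1) rfl v⟫_ℝ
      + ⟪(S.harmonic k).starProjection f, (v : W k)⟫_ℝ + ⟪(0 : W k), (v : W k)⟫_ℝ = _
    rw [map_add, hdA, zero_add, hD.inner_d _ _ _ hdv, ContinuousLinearMap.adjoint_inner_left,
      inner_zero_left, add_zero]
    -- only the cocycle part `v - D (d v)` of `v` contributes to the remaining terms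
    obtain ⟨b, hb, q, hq, hbq⟩ := S.exists_add_of_mem_cocycles hB (hD.sub_mem_cocycles hv)
    rw [sub_eq_iff_eq_add] at hbq
    have hx := hD.orthogonal (C.d k (k + 1) rfl v)
    have hfq : ⟪(S.harmonic k).starProjection f, q⟫_ℝ = ⟪f, q⟫_ℝ := by
      rw [← sub_eq_zero, ← inner_sub_left, ← neg_sub, inner_neg_left, neg_eq_zero]
      exact (Submodule.mem_orthogonal' _ _).1
        (Submodule.sub_starProjection_mem_orthogonal (K := S.harmonic k) f) q hq
    rw [hbq]
    simp only [inner_add_right]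
    rw [hG.inner_d _ _ _ hb, hq.2 _ hσ, real_inner_comm _ (C.d (k - 1) k _ _),
      hx _ (S.coboundaries_le_cocycles k hσ), real_inner_comm b ((S.harmonic k).starProjection f),
      hp.2 _ hb, hfq, real_inner_comm _ ((S.harmonic k).starProjection f), hx _ hp.1]
    ring
  eq_three := by
    intro q hq
    change ⟪ContinuousLinearMap.adjoint G (G f) + D (ContinuousLinearMap.adjoint D f), q⟫_ℝ = 0
    rw [inner_add_left, hD.orthogonal _ _ hq.1, hq.2 _ (hG.adjoint_mem hB _), add_zero]

end Subcomplex

namespace Subcomplex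

variable {S : C.Subcomplex}

/-! ### Properties of solutions of the mixed problem -/

namespace IsMixedSolution

variable {k : ℤ} {F : C.V k → W k} {f f' : W k} {σ σ' : C.V (k - 1)} {u u' p p' : C.V k}

theorem toLinear (hs : S.IsMixedSolution k F f σ u p) :
    S.IsMixedSolution k (fun _ => 0) (f - F (u + p)) σ u p where
  σ_mem := hs.σ_mem
  u_mem := hs.u_mem
  p_mem := hs.p_mem
  eq_one := hs.eq_one
  eq_two v hv := by
    rw [inner_sub_left, ← hs.eq_two v hv, inner_zero_left]
    ring
  eq_three := hs.eq_three

theorem sub (hs : S.IsMixedSolution k (fun _ => 0) f σ u p)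
    (hs' : S.IsMixedSolution k (fun _ => 0) f' σ' u' p') :
    S.IsMixedSolution k (fun _ => 0) (f - f') (σ - σ') (u - u') (p - p') where
  σ_mem := sub_mem hs.σ_mem hs'.σ_mem
  u_mem := sub_mem hs.u_mem hs'.u_mem
  p_mem := sub_mem hs.p_mem hs'.p_mem
  eq_one τ hτ := by
    simp only [AddSubgroupClass.coe_sub, inner_sub_left]
    linarith [hs.eq_one τ hτ, hs'.eq_one τ hτ]
  eq_two v hv := by
    simp only [map_sub, AddSubgroupClass.coe_sub, inner_sub_left]
    have h1 := hs.eq_two v hv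
    have h2 := hs'.eq_two v hv
    rw [inner_zero_left] at h1 h2 ⊢
    linarith
  eq_three q hq := by
    simp only [AddSubgroupClass.coe_sub, inner_sub_left]
    rw [hs.eq_three q hq, hs'.eq_three q hq, sub_self]

theorem inner_σ (hs : S.IsMixedSolution k F f σ u p) {τ : C.V (k - 1)}
    (hτ : (τ : W (k - 1)) ∈ S.space (k - 1)) :
    ⟪(σ : W (k - 1)), (τ : W (k - 1))⟫_ℝ
      = ⟪(u : W k), C.d (k - 1) k (sub_add_cancel k 1) τ⟫_ℝ :=
  sub_eq_zero.1 (hs.eq_one τ hτ)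

theorem inner_σ_cocycle (hs : S.IsMixedSolution k F f σ u p) {z : W (k - 1)}
    (hz : z ∈ S.cocycles (k - 1)) : ⟪(σ : W (k - 1)), z⟫_ℝ = 0 := by
  have h1 := hs.inner_σ (τ := ⟨z, S.le_V _ hz.1⟩) hz.1
  rwa [d_eq_zero_of_mem_cocycles _ (v := ⟨z, S.le_V _ hz.1⟩) hz, inner_zero_right] at h1

theorem dσ_mem (hs : S.IsMixedSolution k F f σ u p) :
    C.d (k - 1) k (sub_add_cancel k 1) σ ∈ S.coboundaries k :=
  d_mem_coboundaries _ hs.σ_mem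

theorem du_mem (hs : S.IsMixedSolution k F f σ u p) :
    C.d k (k + 1) rfl u ∈ S.coboundaries (k + 1) :=
  d_mem_coboundaries _ hs.u_mem

theorem dp_eq_zero (hs : S.IsMixedSolution k F f σ u p) : C.d k (k + 1) rfl p = 0 :=
  d_eq_zero_of_mem_cocycles rfl hs.p_mem.1

theorem inner_d_add_inner_d (hs : S.IsMixedSolution k (fun _ => 0) f σ u p) {v : C.V k}
    (hv : (v : W k) ∈ S.space k) :
    ⟪C.d (k - 1) k (sub_add_cancel k 1) σ, (v : W k)⟫_ℝ
      + ⟪C.d k (k + 1) rfl u, C.d k (k + 1) rfl v⟫_ℝ + ⟪(p : W k), (v : W k)⟫_ℝ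
      = ⟪f, (v : W k)⟫_ℝ := by
  rw [← hs.eq_two v hv, inner_zero_left, add_zero]
  rfl

theorem inner_dσ (hs : S.IsMixedSolution k (fun _ => 0) f σ u p) {b : W k}
    (hb : b ∈ S.coboundaries k) :
    ⟪C.d (k - 1) k (sub_add_cancel k 1) σ, b⟫_ℝ = ⟪f, b⟫_ℝ := by
  have hz := S.coboundaries_le_cocycles k hb
  have h1 := hs.inner_d_add_inner_d (v := ⟨b, S.le_V _ hz.1⟩) hz.1
  rw [d_eq_zero_of_mem_cocycles rfl (v := ⟨b, S.le_V _ hz.1⟩) hz, inner_zero_right, add_zero,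
    real_inner_comm b (p : W k), hs.p_mem.2 _ hb, add_zero] at h1
  exact h1

theorem inner_p (hs : S.IsMixedSolution k (fun _ => 0) f σ u p) {q : W k}
    (hq : q ∈ S.harmonic k) : ⟪(p : W k), q⟫_ℝ = ⟪f, q⟫_ℝ := by
  have h1 := hs.inner_d_add_inner_d (v := ⟨q, S.le_V _ hq.1.1⟩) hq.1.1
  rw [d_eq_zero_of_mem_cocycles rfl (v := ⟨q, S.le_V _ hq.1.1⟩) hq.1, inner_zero_right, add_zero,
    hq.2 _ hs.dσ_mem, zero_add] at h1
  exact h1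

/-- The energy identity, from testing with `u + p`. -/
theorem energy (hs : S.IsMixedSolution k (fun _ => 0) f σ u p) :
    ‖(σ : W (k - 1))‖ ^ 2 + ‖C.d k (k + 1) rfl u‖ ^ 2 + ‖(p : W k)‖ ^ 2
      = ⟪f, (u : W k) + (p : W k)⟫_ℝ := by
  have h1 := hs.inner_d_add_inner_d hs.u_mem
  have h2 := hs.inner_p hs.p_mem
  have h3 := hs.inner_σ hs.σ_mem
  have h4 := hs.eq_three _ hs.p_mem
  rw [real_inner_comm] at h3 h4
  rw [real_inner_self_eq_norm_sq] at h1 h2 h3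
  rw [inner_add_right, ← h1, ← h2, h3, h4]
  rw [real_inner_comm (u : W k), add_zero]

theorem norm_dσ_le (hs : S.IsMixedSolution k (fun _ => 0) f σ u p) :
    ‖C.d (k - 1) k (sub_add_cancel k 1) σ‖ ≤ ‖f‖ := by
  have h1 := hs.inner_dσ hs.dσ_mem
  rw [real_inner_self_eq_norm_sq] at h1
  have h2 := real_inner_le_norm f (C.d (k - 1) k (sub_add_cancel k 1) σ)
  rw [← h1, sq] at h2
  by_contra! hlt
  have h3 := (norm_nonneg f).trans_lt hlt
  exact absurd (le_of_mul_le_mul_right h2 h3) (not_le.2 hlt)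

theorem eq_zero (hs : S.IsMixedSolution k (fun _ => 0) 0 σ u p) :
    (σ : W (k - 1)) = 0 ∧ (u : W k) = 0 ∧ (p : W k) = 0 := by
  have he := hs.energy
  rw [inner_zero_left] at he
  have hσ : ‖(σ : W (k - 1))‖ ^ 2 = 0 := by
    linarith [sq_nonneg ‖(σ : W (k - 1))‖, sq_nonneg ‖C.d k (k + 1) rfl u‖,
      sq_nonneg ‖(p : W k)‖]
  have hu : ‖C.d k (k + 1) rfl u‖ ^ 2 = 0 := by
    linarith [sq_nonneg ‖(σ : W (k - 1))‖, sq_nonneg ‖C.d k (k + 1) rfl u‖,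
      sq_nonneg ‖(p : W k)‖]
  have hp : ‖(p : W k)‖ ^ 2 = 0 := by linarith
  rw [sq_eq_zero_iff, norm_eq_zero] at hσ hu hp
  refine ⟨hσ, ?_, hp⟩
  have hmem : (u : W k) ∈ S.harmonic k := by
    refine ⟨(S.coe_mem_cocycles_iff rfl u).2 ⟨hs.u_mem, hu⟩, ?_⟩
    intro b hb
    obtain ⟨τ, hτ, rfl⟩ := (S.mem_coboundaries_iff (sub_add_cancel k 1) b).1 hb
    rw [real_inner_comm, ← hs.inner_σ hτ, hσ, inner_zero_left]
  exact inner_self_eq_zero.1 (hs.eq_three _ hmem)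

theorem σ_eq {G : W k →L[ℝ] W (k - 1)}
    (hG : S.IsPseudoinverse (k - 1) k (sub_add_cancel k 1) G)
    (hs : S.IsMixedSolution k (fun _ => 0) f σ u p) : (σ : W (k - 1)) = G f :=
  hG.eq_of_inner_d hs.σ_mem (fun _ hz => hs.inner_σ_cocycle hz) fun _ hb => hs.inner_dσ hb

theorem du_eq {D : W (k + 1) →L[ℝ] W k} (hD : S.IsPseudoinverse k (k + 1) rfl D)
    (hs : S.IsMixedSolution k (fun _ => 0) f σ u p) :
    C.d k (k + 1) rfl u = ContinuousLinearMap.adjoint D f := by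
  refine ext_inner_right ℝ fun y => ?_
  have h1 := hs.inner_d_add_inner_d (v := ⟨D y, hD.mem_V y⟩) (hD.mem y)
  rw [real_inner_comm, hD.orthogonal _ _ (S.coboundaries_le_cocycles k hs.dσ_mem), zero_add,
    real_inner_comm _ (p : W k), hD.orthogonal _ _ hs.p_mem.1, add_zero, real_inner_comm,
    hD.inner_d _ _ _ hs.du_mem] at h1
  rw [ContinuousLinearMap.adjoint_inner_left, real_inner_comm, h1]

end IsMixedSolution

end Subcomplex

/-! ### The solution operator -/

section SolutionOperator

variable (hC : C.IsClosedComplex)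

include hC

theorem isMixedSolution_linearSolution (k : ℤ) (f : W k) :
    C.full.IsMixedSolution k (fun _ => 0) f (C.dStarK k f) (C.K k f)
      (C.linearSolution k f).2.2 := by
  obtain ⟨G, hG⟩ := C.full.exists_isPseudoinverse (sub_add_cancel k 1)
    (Subcomplex.isClosed_coboundaries_full hC k)
  obtain ⟨D, hD⟩ := C.full.exists_isPseudoinverse (rfl : k + 1 = k + 1)
    (Subcomplex.isClosed_coboundaries_full hC (k + 1))
  exact Classical.epsilon_spec
    (p := fun s : C.V (k - 1) × C.V k × C.V k =>
      C.full.IsMixedSolution k (fun _ => 0) f s.1 s.2.1 s.2.2)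
    ⟨(_, _, _), Subcomplex.isMixedSolution_of_isPseudoinverse _ hG hD
      (Subcomplex.isClosed_coboundaries_full hC k) f⟩

theorem coe_dStarK {k : ℤ} {G : W k →L[ℝ] W (k - 1)}
    (hG : C.full.IsPseudoinverse (k - 1) k (sub_add_cancel k 1) G) (f : W k) :
    (C.dStarK k f : W (k - 1)) = G f :=
  (isMixedSolution_linearSolution hC k f).σ_eq hG

theorem d_K {k : ℤ} {D : W (k + 1) →L[ℝ] W k} (hD : C.full.IsPseudoinverse k (k + 1) rfl D)
    (f : W k) : C.d k (k + 1) rfl (C.K k f) = ContinuousLinearMap.adjoint D f :=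
  (isMixedSolution_linearSolution hC k f).du_eq hD

theorem coe_K {k : ℤ} {G : W k →L[ℝ] W (k - 1)} {D : W (k + 1) →L[ℝ] W k}
    (hG : C.full.IsPseudoinverse (k - 1) k (sub_add_cancel k 1) G)
    (hD : C.full.IsPseudoinverse k (k + 1) rfl D) (f : W k) :
    (C.K k f : W k) = ContinuousLinearMap.adjoint G (G f)
      + D (ContinuousLinearMap.adjoint D f) := by
  have h1 := (isMixedSolution_linearSolution hC k f).sub
    (Subcomplex.isMixedSolution_of_isPseudoinverse _ hG hD
      (Subcomplex.isClosed_coboundaries_full hC k) f)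
  rw [sub_self] at h1
  exact sub_eq_zero.1 h1.eq_zero.2.1

end SolutionOperator

end HilbertComplex

/-! ### Operator norms -/

section OperatorNorm

variable {X Y : Type*} [NormedAddCommGroup X] [NormedAddCommGroup Y] {T : X → Y} {c : ℝ}

theorem operatorNorm_nonneg : 0 ≤ operatorNorm T := Real.sInf_nonneg fun _ hc => hc.1

theorem operatorNorm_le (hc : 0 ≤ c) (hT : ∀ x, ‖T x‖ ≤ c * ‖x‖) : operatorNorm T ≤ c :=
  csInf_le ⟨0, fun _ hc => hc.1⟩ ⟨hc, hT⟩

/-- Without the bound `hT`, the infimum defining `operatorNorm T` would be the junk value `0`. -/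
theorem le_operatorNorm_mul (hc : 0 ≤ c) (hT : ∀ x, ‖T x‖ ≤ c * ‖x‖) (x : X) :
    ‖T x‖ ≤ operatorNorm T * ‖x‖ := by
  rcases eq_or_ne x 0 with rfl | hx
  · simpa using hT 0
  · rw [← div_le_iff₀ (norm_pos_iff.2 hx)]
    exact le_csInf ⟨c, hc, hT⟩ fun a ha => (div_le_iff₀ (norm_pos_iff.2 hx)).2 (ha.2 x)

end OperatorNorm

/-! ### Norm bounds from orthogonality -/

section InnerProduct

variable {E : Type*} [NormedAddCommGroup E] [InnerProductSpace ℝ E] {a b : E}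

theorem le_of_sq_le_mul {x c : ℝ} (hc : 0 ≤ c) (h : x ^ 2 ≤ c * x) : x ≤ c := by
  by_contra! hlt
  rw [sq] at h
  exact absurd (le_of_mul_le_mul_right h (hc.trans_lt hlt)) (not_le.2 hlt)

theorem norm_le_of_inner_sub_eq_zero (h : ⟪a, a - b⟫_ℝ = 0) : ‖a‖ ≤ ‖b‖ := by
  refine le_of_sq_le_mul (norm_nonneg b) ?_
  rw [inner_sub_right, sub_eq_zero, real_inner_self_eq_norm_sq] at h
  rw [h, mul_comm]
  exact real_inner_le_norm a b

end InnerProduct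

namespace HilbertComplex

variable {W : ℤ → Type w} [∀ k, NormedAddCommGroup (W k)] [∀ k, InnerProductSpace ℝ (W k)]
  [∀ k, CompleteSpace (W k)] {C : HilbertComplex W}

namespace Subcomplex

variable {S : C.Subcomplex}

theorem bestError_nonneg {k : ℤ} (w : W k) : 0 ≤ S.bestError w :=
  Real.iInf_nonneg fun _ => norm_nonneg _

/-! ### Cochain projections -/

namespace CochainProjection

variable (π : S.CochainProjection)

theorem d_map {i j : ℤ} (h : i + 1 = j) (v : C.V i) :
    C.d i j h (π.map i v) = π.map j ⟨C.d i j h v, C.d_mem i j h v⟩ :=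
  (congrArg Subtype.val (π.map_d i j h v)).symm

theorem map_mem_coboundaries {j : ℤ} {b : C.V j} (hb : (b : W j) ∈ C.full.coboundaries j) :
    (π.map j b : W j) ∈ S.coboundaries j := by
  obtain ⟨v, -, hv⟩ := (C.full.mem_coboundaries_iff (sub_add_cancel j 1) _).1 hb
  obtain rfl : b = ⟨_, C.d_mem _ _ (sub_add_cancel j 1) v⟩ := Subtype.ext hv.symm
  rw [← π.d_map]
  exact d_mem_coboundaries _ (π.map_mem _ v)

theorem map_mem_cocycles {j : ℤ} {z : C.V j} (hz : (z : W j) ∈ C.full.cocycles j) :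
    (π.map j z : W j) ∈ S.cocycles j := by
  refine (S.coe_mem_cocycles_iff rfl _).2 ⟨π.map_mem j z, ?_⟩
  rw [π.d_map]
  have h0 : (⟨C.d j (j + 1) rfl z, C.d_mem j (j + 1) rfl z⟩ : C.V (j + 1)) = 0 :=
    Subtype.ext (d_eq_zero_of_mem_cocycles rfl hz)
  rw [h0, map_zero, Submodule.coe_zero]

theorem norm_sub_map_le_bestError {i : ℤ} {m : ℝ} (hm : 0 ≤ m)
    (hstab : ∀ v : C.V i, ‖v - π.map i v‖ ≤ m * ‖v‖) (v : C.V i) :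
    ‖v - π.map i v‖ ≤ m * S.bestError (v : W i) := by
  rw [bestError, Real.mul_iInf_of_nonneg hm]
  refine le_ciInf fun x => ?_
  let x' : C.V i := ⟨x, S.le_V i x.2⟩
  have hx := hstab (v - x')
  rwa [map_sub, π.map_fix i x' x.2, sub_sub_sub_cancel_right] at hx

/-- If `v ∈ S` and `w ∈ V` are both orthogonal to the cocycles of `S` and have the same
differential, then `v - π w` is a cocycle of `S`, so that `v - w` is no longer than `π w - w`. -/
theorem norm_sub_le_of_d_eq {i j : ℤ} (h : i + 1 = j) {v w : C.V i}
    (hv : (v : W i) ∈ S.space i) (hv' : ∀ z ∈ S.cocycles i, ⟪(v : W i), z⟫_ℝ = 0)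
    (hw' : ∀ z ∈ S.cocycles i, ⟪(w : W i), z⟫_ℝ = 0) (hvw : C.d i j h v = C.d i j h w) :
    ‖v - w‖ ≤ ‖w - π.map i w‖ := by
  rw [norm_sub_rev w]
  have hz : ((v - π.map i w : C.V i) : W i) ∈ S.cocycles i := by
    refine (S.coe_mem_cocycles_iff h _).2 ⟨sub_mem hv (π.map_mem i w), ?_⟩
    have h1 := π.d_map h v
    simp only [hvw] at h1
    rw [π.map_fix i v hv] at h1
    rw [map_sub, π.d_map, ← h1, sub_self]
  refine norm_le_of_inner_sub_eq_zero (E := C.V i) ?_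
  rw [sub_sub_sub_cancel_right, Submodule.coe_inner, AddSubgroupClass.coe_sub v w,
    inner_sub_left, hv' _ hz, hw' _ hz, sub_self]

end CochainProjection

/-! ### Bounds on a cochain projection and their consequences -/

/-- The bounds on a cochain projection `π` that enter the error analysis in degree `k`: `G` and `D`
are the pseudoinverses of the differentials `V (k - 1) → W k` and `V k → W (k + 1)`, with norms at
most `N`; `I - π` has norm at most `m` in the degrees `k - 1`, `k`, `k + 1`; and the numbers
`η`, `δ`, `μ` bound `I - π` on the ranges of `G`, `G*`, `D`, on the range of `K` over the
coboundaries, where `K = G* G`, and on the harmonic space. -/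
structure ProjectionBounds (π : S.CochainProjection) (k : ℤ) (G : W k →L[ℝ] W (k - 1))
    (D : W (k + 1) →L[ℝ] W k) (m N η δ μ : ℝ) : Prop where
  closed : C.IsClosedComplex
  pinv_G : C.full.IsPseudoinverse (k - 1) k (sub_add_cancel k 1) G
  pinv_D : C.full.IsPseudoinverse k (k + 1) rfl D
  norm_G : ‖G‖ ≤ N
  norm_D : ‖D‖ ≤ N
  m_nonneg : 0 ≤ m
  η_nonneg : 0 ≤ η
  δ_nonneg : 0 ≤ δ
  μ_nonneg : 0 ≤ μ
  stable : ∀ i, k - 1 ≤ i → i ≤ k + 1 → ∀ v : C.V i, ‖v - π.map i v‖ ≤ m * ‖v‖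
  bound_G : ∀ (y : W k) (hy : G y ∈ C.V (k - 1)),
    ‖(⟨G y, hy⟩ : C.V (k - 1)) - π.map (k - 1) ⟨G y, hy⟩‖ ≤ η * ‖y‖
  bound_adjoint_G : ∀ (x : W (k - 1)) (hx : ContinuousLinearMap.adjoint G x ∈ C.V k),
    ‖(⟨ContinuousLinearMap.adjoint G x, hx⟩ : C.V k)
      - π.map k ⟨ContinuousLinearMap.adjoint G x, hx⟩‖ ≤ η * ‖x‖
  bound_D : ∀ (y : W (k + 1)) (hy : D y ∈ C.V k),
    ‖(⟨D y, hy⟩ : C.V k) - π.map k ⟨D y, hy⟩‖ ≤ η * ‖y‖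
  bound_K : ∀ b ∈ C.full.coboundaries k,
    ∀ hx : ContinuousLinearMap.adjoint G (G b) ∈ C.V k,
    ‖(⟨ContinuousLinearMap.adjoint G (G b), hx⟩ : C.V k)
      - π.map k ⟨ContinuousLinearMap.adjoint G (G b), hx⟩‖ ≤ δ * ‖b‖
  bound_harmonic : ∀ q : C.V k, (q : W k) ∈ C.full.harmonic k → ‖q - π.map k q‖ ≤ μ * ‖q‖

namespace ProjectionBounds

variable {π : S.CochainProjection} {k : ℤ} {G : W k →L[ℝ] W (k - 1)} {D : W (k + 1) →L[ℝ] W k}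
  {m N η δ μ : ℝ} (A : ProjectionBounds π k G D m N η δ μ)

include A

theorem N_nonneg : 0 ≤ N := (norm_nonneg G).trans A.norm_G

theorem norm_sub_map_le {i : ℤ} (hi : k - 1 ≤ i) (hi' : i ≤ k + 1) (v : C.V i) :
    ‖v - π.map i v‖ ≤ m * S.bestError (v : W i) :=
  π.norm_sub_map_le_bestError A.m_nonneg (A.stable i hi hi') v

/-- An element of `S` orthogonal to the cocycles of `S` is close to the element of `V` orthogonal
to all cocycles that has the same differential. -/
theorem norm_sub_D_le {v : C.V k} (hv : (v : W k) ∈ S.space k)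
    (hv' : (v : W k) ∈ (S.cocycles k)ᗮ) :
    ‖(v : W k) - D (C.d k (k + 1) rfl v)‖ ≤ η * ‖C.d k (k + 1) rfl v‖ := by
  have hb := S.coboundaries_le_full _ (d_mem_coboundaries (rfl : k + 1 = k + 1) hv)
  refine le_trans ?_ (A.bound_D _ (A.pinv_D.mem_V _))
  exact π.norm_sub_le_of_d_eq rfl hv ((Submodule.mem_orthogonal' _ _).1 hv')
    (fun z hz => A.pinv_D.orthogonal _ z (S.cocycles_le_full k hz)) (A.pinv_D.d_apply hb).symm

theorem norm_sub_G_le {v : C.V (k - 1)} (hv : (v : W (k - 1)) ∈ S.space (k - 1))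
    (hv' : (v : W (k - 1)) ∈ (S.cocycles (k - 1))ᗮ) :
    ‖(v : W (k - 1)) - G (C.d (k - 1) k (sub_add_cancel k 1) v)‖
      ≤ η * ‖C.d (k - 1) k (sub_add_cancel k 1) v‖ := by
  have hb := S.coboundaries_le_full _ (d_mem_coboundaries (sub_add_cancel k 1) hv)
  refine le_trans ?_ (A.bound_G _ (A.pinv_G.mem_V _))
  exact π.norm_sub_le_of_d_eq _ hv ((Submodule.mem_orthogonal' _ _).1 hv')
    (fun z hz => A.pinv_G.orthogonal _ z (S.cocycles_le_full _ hz)) (A.pinv_G.d_apply hb).symm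

/-- The discrete Poincaré inequality, with a constant that does not depend on `S`. -/
theorem norm_le_of_mem_orthogonal_cocycles {v : C.V k} (hv : (v : W k) ∈ S.space k)
    (hv' : (v : W k) ∈ (S.cocycles k)ᗮ) :
    ‖(v : W k)‖ ≤ (η + N) * ‖C.d k (k + 1) rfl v‖ := by
  have h1 := A.norm_sub_D_le hv hv'
  have h2 := D.le_of_opNorm_le A.norm_D (C.d k (k + 1) rfl v)
  have h3 := norm_le_norm_sub_add (v : W k) (D (C.d k (k + 1) rfl v))
  linarith

theorem norm_le_of_mem_orthogonal_cocycles_pred {v : C.V (k - 1)}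
    (hv : (v : W (k - 1)) ∈ S.space (k - 1))
    (hv' : (v : W (k - 1)) ∈ (S.cocycles (k - 1))ᗮ) :
    ‖(v : W (k - 1))‖ ≤ (η + N) * ‖C.d (k - 1) k (sub_add_cancel k 1) v‖ := by
  have h1 := A.norm_sub_G_le hv hv'
  have h2 := G.le_of_opNorm_le A.norm_G (C.d (k - 1) k (sub_add_cancel k 1) v)
  have h3 := norm_le_norm_sub_add (v : W (k - 1)) (G (C.d (k - 1) k (sub_add_cancel k 1) v))
  linarith

/-- A duality argument: as `π` maps coboundaries to coboundaries of `S`, an element orthogonal to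
the latter sees only the part `(I - π) G* x` of `G* x`. -/
theorem norm_G_le {y : W k} (hy : ∀ b ∈ S.coboundaries k, ⟪y, b⟫_ℝ = 0) :
    ‖G y‖ ≤ η * ‖y‖ := by
  have hB := isClosed_coboundaries_full A.closed k
  have hmem := A.pinv_G.adjoint_mem hB (G y)
  have hV := C.full.le_V k (C.full.coboundaries_le_cocycles k hmem).1
  refine le_of_sq_le_mul (mul_nonneg A.η_nonneg (norm_nonneg y)) ?_
  let x : C.V k := ⟨ContinuousLinearMap.adjoint G (G y), hV⟩
  have h1 : ‖G y‖ ^ 2 = ⟪y, ((x - π.map k x : C.V k) : W k)⟫_ℝ := by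
    rw [AddSubgroupClass.coe_sub, inner_sub_right, hy _ (π.map_mem_coboundaries hmem), sub_zero,
      ← real_inner_self_eq_norm_sq, ← ContinuousLinearMap.adjoint_inner_right]
  rw [h1]
  calc _ ≤ ‖y‖ * ‖x - π.map k x‖ := real_inner_le_norm _ _
    _ ≤ ‖y‖ * (η * ‖G y‖) := by gcongr; exact A.bound_adjoint_G _ _
    _ = _ := by ring

theorem inner_G_G_le {y b : W k} (hy : ∀ b ∈ S.coboundaries k, ⟪y, b⟫_ℝ = 0)
    (hb : b ∈ C.full.coboundaries k) : ⟪G y, G b⟫_ℝ ≤ δ * ‖y‖ * ‖b‖ := by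
  have hB := isClosed_coboundaries_full A.closed k
  have hmem := A.pinv_G.adjoint_mem hB (G b)
  have hV := C.full.le_V k (C.full.coboundaries_le_cocycles k hmem).1
  let x : C.V k := ⟨ContinuousLinearMap.adjoint G (G b), hV⟩
  have h1 : ⟪G y, G b⟫_ℝ = ⟪y, ((x - π.map k x : C.V k) : W k)⟫_ℝ := by
    rw [AddSubgroupClass.coe_sub, inner_sub_right, hy _ (π.map_mem_coboundaries hmem), sub_zero,
      ← ContinuousLinearMap.adjoint_inner_right]
  rw [h1]
  calc _ ≤ ‖y‖ * ‖x - π.map k x‖ := real_inner_le_norm _ _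
    _ ≤ ‖y‖ * (δ * ‖b‖) := by gcongr; exact A.bound_K _ hb _
    _ = _ := by ring

/-- The gap between the harmonic spaces: a harmonic element `q` of `S` has a coboundary part of
norm at most `μ ‖q‖`. -/
theorem exists_harmonic_gap {q : W k} (hq : q ∈ S.harmonic k) :
    ∃ b ∈ C.full.coboundaries k, ∃ q₀ ∈ C.full.harmonic k, q = b + q₀ ∧ ‖b‖ ≤ μ * ‖q‖ := by
  obtain ⟨b, hb, q₀, hq₀, hqb⟩ := C.full.exists_add_of_mem_cocycles
    (isClosed_coboundaries_full A.closed k) (S.cocycles_le_full k hq.1)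
  refine ⟨b, hb, q₀, hq₀, hqb, ?_⟩
  have hbV := (C.full.coboundaries_le_cocycles k hb).1
  let b' : C.V k := ⟨b, hbV⟩
  let q' : C.V k := ⟨q₀, hq₀.1.1⟩
  have hπb := π.map_mem_coboundaries (b := b') hb
  have hfix : π.map k (b' + q') = b' + q' := π.map_fix k _ (by
    change b + q₀ ∈ _
    rw [← hqb]
    exact hq.1.1)
  have h1 : ‖b'‖ ≤ ‖q' - π.map k q'‖ := by
    rw [norm_sub_rev]
    refine norm_le_of_inner_sub_eq_zero ?_
    -- `q - π q₀ = π b` is a coboundary of `S`, to which both `q` and `q₀` are orthogonal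
    have h2 : b' - (π.map k q' - q') = π.map k b' := by
      rw [map_add] at hfix
      rw [← add_left_inj (π.map k q'), hfix]
      abel
    have h3 : b = q - q₀ := by rw [hqb, add_sub_cancel_right]
    rw [h2, Submodule.coe_inner]
    change ⟪b, (π.map k b' : W k)⟫_ℝ = 0
    rw [h3, inner_sub_left, real_inner_comm, hq.2 _ hπb, real_inner_comm,
      hq₀.2 _ (S.coboundaries_le_full k hπb), sub_zero]
  have h2 : ‖q₀‖ ≤ ‖q‖ := by
    refine norm_le_of_inner_sub_eq_zero ?_
    rw [hqb, sub_add_cancel_right, inner_neg_right, real_inner_comm, hq₀.2 _ hb, neg_zero]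
  calc ‖b‖ ≤ ‖q' - π.map k q'‖ := h1
    _ ≤ μ * ‖q₀‖ := A.bound_harmonic q' hq₀
    _ ≤ μ * ‖q‖ := by gcongr; exact A.μ_nonneg

theorem abs_inner_harmonic_le {q : W k} (hq : q ∈ S.harmonic k) {x : W k}
    (hx : x ∈ C.full.coboundaries k) :
    |⟪x, q⟫_ℝ| ≤ μ * (m * S.bestError x) * ‖q‖ := by
  obtain ⟨b, hb, q₀, hq₀, hqb, hbound⟩ := A.exists_harmonic_gap hq
  let x' : C.V k := ⟨x, (C.full.coboundaries_le_cocycles k hx).1⟩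
  have hπx := π.map_mem_coboundaries (b := x') hx
  have h1 : ⟪x, q⟫_ℝ = ⟪((x' - π.map k x' : C.V k) : W k), b⟫_ℝ := by
    have h2 : ⟪((x' - π.map k x' : C.V k) : W k), q⟫_ℝ = ⟪x, q⟫_ℝ := by
      rw [AddSubgroupClass.coe_sub, inner_sub_left, hq.2 _ hπx, sub_zero]
    have h3 : ⟪((x' - π.map k x' : C.V k) : W k), q₀⟫_ℝ = 0 :=
      hq₀.2 _ (sub_mem hx (S.coboundaries_le_full k hπx))
    rw [← h2, hqb, inner_add_right, h3, add_zero]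
  rw [h1]
  calc _ ≤ ‖x' - π.map k x'‖ * ‖b‖ := abs_real_inner_le_norm _ _
    _ ≤ (m * S.bestError x) * (μ * ‖q‖) := by
        gcongr
        · exact mul_nonneg A.m_nonneg (bestError_nonneg x)
        · exact A.norm_sub_map_le (by omega) (by omega) x'
    _ = _ := by ring

end ProjectionBounds

end Subcomplex

theorem inner_sub_projB (k : ℤ) (x : W k) {b : W k} (hb : b ∈ C.full.coboundaries k) :
    ⟪x - C.projB k x, b⟫_ℝ = 0 :=
  (Submodule.mem_orthogonal' _ _).1 (Submodule.sub_starProjection_mem_orthogonal x) b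
    (Submodule.le_topologicalClosure _ hb)

theorem projB_mem (hC : C.IsClosedComplex) (k : ℤ) (x : W k) :
    C.projB k x ∈ C.full.coboundaries k := by
  have h1 : C.projB k x ∈ (C.full.coboundaries k).topologicalClosure :=
    Submodule.starProjection_apply_mem _ x
  rwa [(Subcomplex.isClosed_coboundaries_full hC k).submodule_topologicalClosure_eq] at h1

namespace Subcomplex

variable {S : C.Subcomplex}

/-! ### Error estimates for the linear problem -/

namespace ProjectionBounds

variable {π : S.CochainProjection} {k : ℤ} {G : W k →L[ℝ] W (k - 1)} {D : W (k + 1) →L[ℝ] W k}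
  {m N η δ μ : ℝ} (A : ProjectionBounds π k G D m N η δ μ) {g : W k}
  {σ σ' : C.V (k - 1)} {u u' p p' : C.V k}
  (hs : C.full.IsMixedSolution k (fun _ => 0) g σ u p)
  (hs' : S.IsMixedSolution k (fun _ => 0) g σ' u' p')

include hs hs' in
theorem inner_d_sub_eq_zero {b : W k} (hb : b ∈ S.coboundaries k) :
    ⟪C.d (k - 1) k (sub_add_cancel k 1) (σ - σ'), b⟫_ℝ = 0 := by
  rw [map_sub, inner_sub_left, hs.inner_dσ (S.coboundaries_le_full k hb), hs'.inner_dσ hb,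
    sub_self]

include A hs hs'

theorem norm_dσ_sub_le :
    ‖C.d (k - 1) k (sub_add_cancel k 1) (σ - σ')‖
      ≤ m * S.bestError (C.d (k - 1) k (sub_add_cancel k 1) σ) := by
  let x : C.V k := ⟨C.d (k - 1) k (sub_add_cancel k 1) σ, C.d_mem _ _ _ σ⟩
  refine le_trans ?_ (A.norm_sub_map_le (by omega) (by omega) x)
  refine norm_le_of_inner_sub_eq_zero (b := ((x - π.map k x : C.V k) : W k)) ?_
  refine inner_d_sub_eq_zero hs hs' ?_
  rw [map_sub, AddSubgroupClass.coe_sub, sub_sub_sub_cancel_left]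
  exact sub_mem (π.map_mem_coboundaries hs.dσ_mem) hs'.dσ_mem

/-- The error of `σ` is split at `G (d σ')`, the element of `V` orthogonal to the cocycles with the
same differential as `σ'`. -/
theorem norm_σ_sub_le :
    ‖σ - σ'‖ ≤ m * S.bestError (σ : W (k - 1))
      + 2 * η * ‖C.d (k - 1) k (sub_add_cancel k 1) (σ - σ')‖ := by
  set e := C.d (k - 1) k (sub_add_cancel k 1) (σ - σ') with he
  let r : C.V (k - 1) := ⟨G e, A.pinv_G.mem_V e⟩
  have hb' := S.coboundaries_le_full k hs'.dσ_mem
  have hσ : G (C.d (k - 1) k (sub_add_cancel k 1) σ) = σ :=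
    A.pinv_G.apply_d hs.σ_mem fun z hz => hs.inner_σ_cocycle hz
  have hρ : ((σ - r : C.V (k - 1)) : W (k - 1))
      = G (C.d (k - 1) k (sub_add_cancel k 1) σ') := by
    change (σ : W (k - 1)) - G e = _
    rw [he, map_sub, map_sub, hσ, sub_sub_cancel]
  have h1 : ‖r‖ ≤ η * ‖e‖ := A.norm_G_le fun b hb => inner_d_sub_eq_zero hs hs' hb
  have h2 : ‖σ' - (σ - r)‖ ≤ ‖(σ - r) - π.map (k - 1) (σ - r)‖ := by
    refine π.norm_sub_le_of_d_eq (sub_add_cancel k 1) hs'.σ_mem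
      (fun z hz => hs'.inner_σ_cocycle hz) (fun z hz => ?_) ?_
    · rw [hρ]
      exact A.pinv_G.orthogonal _ z (S.cocycles_le_full _ hz)
    · have h3 : σ - r = ⟨_, A.pinv_G.mem_V _⟩ := Subtype.ext hρ
      rw [h3, A.pinv_G.d_apply hb']
  have h4 : ‖(σ - r) - π.map (k - 1) (σ - r)‖
      ≤ m * S.bestError (σ : W (k - 1)) + η * ‖e‖ := by
    have h5 : (σ - r) - π.map (k - 1) (σ - r)
        = (σ - π.map (k - 1) σ) - (r - π.map (k - 1) r) := by
      rw [map_sub]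
      abel
    rw [h5]
    exact (norm_sub_le _ _).trans (add_le_add (A.norm_sub_map_le le_rfl (by omega) σ)
      (A.bound_G e _))
  have h6 : σ - σ' = r - (σ' - (σ - r)) := by abel
  rw [h6]
  linarith [norm_sub_le r (σ' - (σ - r))]

theorem norm_p_sub_le :
    ‖p - p'‖ ≤ 2 * (m * S.bestError (p : W k))
      + μ * (m * S.bestError (C.d (k - 1) k (sub_add_cancel k 1) σ)) := by
  obtain ⟨b, hb, q, hq, hbq⟩ := S.exists_add_of_mem_cocycles
    (isClosed_coboundaries A.closed π k) (π.map_mem_cocycles hs.p_mem.1)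
  have hE := A.norm_sub_map_le (by omega) (by omega) p
  -- the harmonic part `q` of `π p` approximates `p` at least as well as `π p` does
  have h1 : ‖(p : W k) - q‖ ≤ m * S.bestError (p : W k) := by
    refine le_trans (norm_le_of_inner_sub_eq_zero
      (b := ((p - π.map k p : C.V k) : W k)) ?_) hE
    rw [AddSubgroupClass.coe_sub, sub_sub_sub_cancel_left, hbq, add_sub_cancel_right,
      real_inner_comm, inner_sub_right, hs.p_mem.2 _ (S.coboundaries_le_full k hb), hq.2 _ hb,
      sub_self]
  have hr := sub_mem hq hs'.p_mem
  have h2 : ‖q - (p' : W k)‖ ≤ m * S.bestError (p : W k)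
      + μ * (m * S.bestError (C.d (k - 1) k (sub_add_cancel k 1) σ)) := by
    have hbE := bestError_nonneg (S := S) (C.d (k - 1) k (sub_add_cancel k 1) σ)
    have hpE := bestError_nonneg (S := S) (p : W k)
    have hm := A.m_nonneg
    have hμ := A.μ_nonneg
    refine le_of_sq_le_mul (by positivity) ?_
    have h3 := hs.inner_d_add_inner_d (v := ⟨_, S.harmonic_le_V k hr⟩) (S.harmonic_le_V k hr)
    rw [d_eq_zero_of_mem_cocycles rfl (v := ⟨_, S.harmonic_le_V k hr⟩) hr.1, inner_zero_right,
      add_zero, ← hs'.inner_p hr] at h3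
    have h4 := (neg_le_abs _).trans (A.abs_inner_harmonic_le hr hs.dσ_mem)
    have h5 : ⟪q - (p : W k), q - (p' : W k)⟫_ℝ
        ≤ m * S.bestError (p : W k) * ‖q - (p' : W k)‖ := by
      refine (real_inner_le_norm _ _).trans ?_
      rw [norm_sub_rev]
      gcongr
    have h6 : ‖q - (p' : W k)‖ ^ 2 = ⟪q - (p : W k), q - (p' : W k)⟫_ℝ
        - ⟪C.d (k - 1) k (sub_add_cancel k 1) σ, q - (p' : W k)⟫_ℝ := by
      rw [← real_inner_self_eq_norm_sq, inner_sub_left q, inner_sub_left q]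
      dsimp only at h3
      linarith
    rw [h6]
    linarith
  have h7 := norm_sub_le_norm_sub_add_norm_sub (p : W k) q (p' : W k)
  change ‖(p : W k) - p'‖ ≤ _
  linarith

theorem norm_du_sub_le :
    ‖C.d k (k + 1) rfl (u - u')‖ ≤ 2 * (m * S.bestError (C.d k (k + 1) rfl u))
      + η * (‖C.d (k - 1) k (sub_add_cancel k 1) (σ - σ')‖ + ‖p - p'‖) := by
  set e := C.d (k - 1) k (sub_add_cancel k 1) (σ - σ') with he
  have hx : ((π.map k u - u' : C.V k) : W k) ∈ S.space k :=
    sub_mem (π.map_mem k u) hs'.u_mem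
  -- the test function: `v` orthogonal to the cocycles of `S`, with `d v = d (π u - u')`
  obtain ⟨v, hv, hv', -, hdv⟩ := S.exists_orthogonal_cocycles (rfl : k + 1 = k + 1) hx
  let du : C.V (k + 1) := ⟨C.d k (k + 1) rfl u, C.d_mem _ _ _ u⟩
  have hE := A.norm_sub_map_le (by omega) le_rfl du
  have hw : C.d k (k + 1) rfl v
      = C.d k (k + 1) rfl (u - u') - ((du - π.map (k + 1) du : C.V (k + 1)) : W (k + 1)) := by
    rw [hdv, map_sub, map_sub, π.d_map, AddSubgroupClass.coe_sub]
    abel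
  have hr : e + ((p - p' : C.V k) : W k) ∈ C.full.cocycles k := by
    refine add_mem (C.full.coboundaries_le_cocycles k (d_mem_coboundaries _ (σ - σ').2))
      (sub_mem hs.p_mem.1 (S.cocycles_le_full k hs'.p_mem.1))
  -- the cocycle `d (σ - σ') + (p - p')` is orthogonal to the range of `D`
  have hinner : ⟪C.d k (k + 1) rfl (u - u'), C.d k (k + 1) rfl v⟫_ℝ
      = -⟪e + ((p - p' : C.V k) : W k),
          (v : W k) - D (C.d k (k + 1) rfl v)⟫_ℝ := by
    have h1 := hs.inner_d_add_inner_d (S.le_V k hv)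
    have h2 := hs'.inner_d_add_inner_d hv
    rw [inner_sub_right, real_inner_comm (D _), A.pinv_D.orthogonal _ _ hr, sub_zero, he]
    simp only [map_sub, AddSubgroupClass.coe_sub, inner_sub_left, inner_add_left]
    linarith
  have hwn : ‖C.d k (k + 1) rfl v‖ ≤ m * S.bestError (C.d k (k + 1) rfl u)
      + η * (‖e‖ + ‖p - p'‖) := by
    have hE0 := bestError_nonneg (S := S) (C.d k (k + 1) rfl u)
    have hm := A.m_nonneg
    have hη := A.η_nonneg
    refine le_of_sq_le_mul (by positivity) ?_
    have h1 : ‖C.d k (k + 1) rfl v‖ ^ 2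
        = ⟪C.d k (k + 1) rfl (u - u'), C.d k (k + 1) rfl v⟫_ℝ
          - ⟪((du - π.map (k + 1) du : C.V (k + 1)) : W (k + 1)), C.d k (k + 1) rfl v⟫_ℝ := by
      rw [← inner_sub_left, ← hw, real_inner_self_eq_norm_sq]
    have h2 : -⟪e + ((p - p' : C.V k) : W k), (v : W k) - D (C.d k (k + 1) rfl v)⟫_ℝ
        ≤ (‖e‖ + ‖p - p'‖) * (η * ‖C.d k (k + 1) rfl v‖) := by
      refine (neg_le_abs _).trans ((abs_real_inner_le_norm _ _).trans ?_)
      gcongr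
      · exact norm_add_le _ _
      · exact A.norm_sub_D_le hv hv'
    have h3 : -⟪((du - π.map (k + 1) du : C.V (k + 1)) : W (k + 1)), C.d k (k + 1) rfl v⟫_ℝ
        ≤ m * S.bestError (C.d k (k + 1) rfl u) * ‖C.d k (k + 1) rfl v‖ := by
      refine (neg_le_abs _).trans ((abs_real_inner_le_norm _ _).trans ?_)
      gcongr
      exact hE
    rw [h1, hinner]
    linarith
  have h4 : C.d k (k + 1) rfl (u - u') = C.d k (k + 1) rfl v
      + ((du - π.map (k + 1) du : C.V (k + 1)) : W (k + 1)) := by rw [hw, sub_add_cancel]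
  rw [h4]
  refine (norm_add_le _ _).trans ?_
  have hE' : ‖((du - π.map (k + 1) du : C.V (k + 1)) : W (k + 1))‖
      ≤ m * S.bestError (C.d k (k + 1) rfl u) := hE
  linarith

/-- The difference `π u - u'` is split by the discrete Hodge decomposition; its coboundary part is
controlled by `σ - σ'`, its harmonic part by the gap between the harmonic spaces, and the part
orthogonal to the cocycles by the discrete Poincaré inequality. -/
theorem norm_u_sub_le :
    ‖u - u'‖ ≤ 3 * (m * S.bestError (u : W k))
      + (η + N) * (m * S.bestError (C.d k (k + 1) rfl u) + ‖C.d k (k + 1) rfl (u - u')‖)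
      + μ * (m * S.bestError (C.projB k u)) + η * ‖σ - σ'‖
      + δ * ‖C.d (k - 1) k (sub_add_cancel k 1) (σ - σ')‖ := by
  have hEu := bestError_nonneg (S := S) (u : W k)
  have hEB := bestError_nonneg (S := S) (C.projB k u)
  have hm := A.m_nonneg
  have hη := A.η_nonneg
  have hδ := A.δ_nonneg
  have hμ := A.μ_nonneg
  have hN := A.N_nonneg
  set x : C.V k := π.map k u - u' with hx_def
  have hx : (x : W k) ∈ S.space k := sub_mem (π.map_mem k u) hs'.u_mem
  have hxu : (x : W k) = ((u - u' : C.V k) : W k) - ((u - π.map k u : C.V k) : W k) := by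
    rw [← AddSubgroupClass.coe_sub, hx_def]
    congr 1
    abel
  have hE : ‖((u - π.map k u : C.V k) : W k)‖ ≤ m * S.bestError (u : W k) :=
    A.norm_sub_map_le (by omega) (by omega) u
  obtain ⟨v, hv, hv', hxv, hdv⟩ := S.exists_orthogonal_cocycles (rfl : k + 1 = k + 1) hx
  obtain ⟨b, hb, q, hq, hbq⟩ := S.exists_add_of_mem_cocycles
    (isClosed_coboundaries A.closed π k) hxv
  have hvb : ⟪(v : W k), b⟫_ℝ = 0 :=
    (Submodule.mem_orthogonal' _ _).1 hv' b (S.coboundaries_le_cocycles k hb)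
  have hvq : ⟪(v : W k), q⟫_ℝ = 0 := (Submodule.mem_orthogonal' _ _).1 hv' q hq.1
  have hbq0 : ⟪b, q⟫_ℝ = 0 := hq.2 _ hb
  have hx_eq : (x : W k) = b + q + v := by rw [← hbq, sub_add_cancel]
  -- the part of `π u - u'` orthogonal to the cocycles
  have hvn : ‖(v : W k)‖ ≤ (η + N)
      * (m * S.bestError (C.d k (k + 1) rfl u) + ‖C.d k (k + 1) rfl (u - u')‖) := by
    refine (A.norm_le_of_mem_orthogonal_cocycles hv hv').trans ?_
    gcongr
    let du : C.V (k + 1) := ⟨C.d k (k + 1) rfl u, C.d_mem _ _ _ u⟩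
    have hEdu : ‖((du - π.map (k + 1) du : C.V (k + 1)) : W (k + 1))‖
        ≤ m * S.bestError (C.d k (k + 1) rfl u) := A.norm_sub_map_le (by omega) le_rfl du
    have hw : C.d k (k + 1) rfl v
        = C.d k (k + 1) rfl (u - u')
          - ((du - π.map (k + 1) du : C.V (k + 1)) : W (k + 1)) := by
      rw [hdv, map_sub, map_sub, π.d_map, AddSubgroupClass.coe_sub]
      abel
    rw [hw]
    linarith [norm_sub_le (C.d k (k + 1) rfl (u - u'))
      ((du - π.map (k + 1) du : C.V (k + 1)) : W (k + 1))]
  have hneg : ∀ y : W k, -⟪((u - π.map k u : C.V k) : W k), y⟫_ℝ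
      ≤ m * S.bestError (u : W k) * ‖y‖ := by
    intro y
    refine (neg_le_abs _).trans ((abs_real_inner_le_norm _ _).trans ?_)
    gcongr
  -- the harmonic part: `u'` has none, and `u` contributes only through its coboundary part
  have hqn : ‖q‖ ≤ m * S.bestError (u : W k) + μ * (m * S.bestError (C.projB k u)) := by
    refine le_of_sq_le_mul (by positivity) ?_
    obtain ⟨b₁, hb₁, q₁, hq₁, hbq₁, -⟩ := A.exists_harmonic_gap hq
    have h1 : ⟪(u : W k), q⟫_ℝ = ⟪C.projB k u, q⟫_ℝ := by
      have h2 := inner_sub_projB k (u : W k) hb₁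
      have h3 := hs.eq_three q₁ hq₁
      have h4 := hq₁.2 _ (projB_mem A.closed k (u : W k))
      rw [inner_sub_left] at h2
      rw [hbq₁, inner_add_right, inner_add_right]
      linarith
    have h5 : ‖q‖ ^ 2 = ⟪(x : W k), q⟫_ℝ := by
      rw [hx_eq, inner_add_left, inner_add_left, hbq0, hvq, real_inner_self_eq_norm_sq]
      ring
    have h6 := (le_abs_self _).trans <| A.abs_inner_harmonic_le hq (projB_mem A.closed k (u : W k))
    have h7 := hs'.eq_three q hq
    rw [h5, hxu, inner_sub_left, AddSubgroupClass.coe_sub, inner_sub_left, h1, h7]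
    linarith [hneg q]
  -- the coboundary part: with `b = d τ` and `τ` orthogonal to the cocycles of `S`, the pairing
  -- `⟪u - u', b⟫ = ⟪σ - σ', τ⟫` is split at `G b`
  have hbn : ‖b‖ ≤ m * S.bestError (u : W k) + η * ‖σ - σ'‖
      + δ * ‖C.d (k - 1) k (sub_add_cancel k 1) (σ - σ')‖ := by
    refine le_of_sq_le_mul (by positivity) ?_
    obtain ⟨τ₀, hτ₀, hbτ₀⟩ := (S.mem_coboundaries_iff (sub_add_cancel k 1) b).1 hb
    obtain ⟨τ, hτ, hτ', -, hbτ⟩ := S.exists_orthogonal_cocycles (sub_add_cancel k 1) hτ₀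
    rw [hbτ₀] at hbτ
    have h1 : ‖b‖ ^ 2 = ⟪(x : W k), b⟫_ℝ := by
      rw [hx_eq, inner_add_left, inner_add_left, real_inner_comm b q, hbq0, hvb,
        real_inner_self_eq_norm_sq]
      ring
    have h2 : ⟪((u - u' : C.V k) : W k), b⟫_ℝ
        = ⟪((σ - σ' : C.V (k - 1)) : W (k - 1)), (τ : W (k - 1))⟫_ℝ := by
      rw [AddSubgroupClass.coe_sub, AddSubgroupClass.coe_sub, inner_sub_left, inner_sub_left,
        hs.inner_σ (S.le_V _ hτ), hs'.inner_σ hτ, hbτ]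
    have h3 : ⟪((σ - σ' : C.V (k - 1)) : W (k - 1)), (τ : W (k - 1)) - G b⟫_ℝ
        ≤ η * ‖σ - σ'‖ * ‖b‖ := by
      have h4 := A.norm_sub_G_le hτ hτ'
      rw [hbτ] at h4
      calc _ ≤ ‖σ - σ'‖ * ‖(τ : W (k - 1)) - G b‖ := real_inner_le_norm _ _
        _ ≤ ‖σ - σ'‖ * (η * ‖b‖) := by gcongr
        _ = _ := by ring
    have h5 : ⟪((σ - σ' : C.V (k - 1)) : W (k - 1)), G b⟫_ℝ
        ≤ δ * ‖C.d (k - 1) k (sub_add_cancel k 1) (σ - σ')‖ * ‖b‖ := by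
      refine le_trans (le_of_eq ?_) (A.inner_G_G_le
        (fun b hb => inner_d_sub_eq_zero hs hs' hb) (S.coboundaries_le_full k hb))
      have h6 := A.pinv_G.orthogonal b _ (A.pinv_G.sub_mem_cocycles (σ - σ').2)
      rw [real_inner_comm, inner_sub_left] at h6
      linarith
    rw [h1, hxu, inner_sub_left, h2]
    rw [inner_sub_right] at h3
    linarith [hneg b]
  have hfin : ‖u - u'‖ ≤ ‖b‖ + ‖q‖ + ‖(v : W k)‖ + m * S.bestError (u : W k) := by
    have h1 : ((u - u' : C.V k) : W k) = b + q + v + ((u - π.map k u : C.V k) : W k) := by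
      rw [← hx_eq, hxu, sub_add_cancel]
    change ‖((u - u' : C.V k) : W k)‖ ≤ _
    rw [h1]
    linarith [norm_add_le (b + q + (v : W k)) ((u - π.map k u : C.V k) : W k),
      norm_add₃_le (a := b) (b := q) (c := (v : W k))]
  linarith

end ProjectionBounds

end Subcomplex

theorem normV_le {k : ℤ} (v : C.V k) : C.normV v ≤ ‖v‖ + ‖C.d k (k + 1) rfl v‖ := by
  refine Real.sqrt_le_iff.2 ⟨by positivity, ?_⟩
  change ‖v‖ ^ 2 + ‖C.d k (k + 1) rfl v‖ ^ 2 ≤ _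
  nlinarith [mul_nonneg (norm_nonneg v) (norm_nonneg (C.d k (k + 1) rfl v))]

namespace Subcomplex

variable {S : C.Subcomplex}

/-! ### The numbers `η`, `δ` and `μ` of a cochain projection -/

namespace CochainProjection

variable (π : S.CochainProjection) (hC : C.IsClosedComplex) {m : ℝ} (hm : 0 ≤ m)

include hC hm

theorem normDK_bounds {i j : ℤ} {h : i + 1 = j} {D : W j →L[ℝ] W i}
    (hD : C.full.IsPseudoinverse i j h D)
    (hstab : ∀ v : C.V j, ‖v - π.map j v‖ ≤ m * ‖v‖) :
    (∀ (f : W i) (hx : ContinuousLinearMap.adjoint D f ∈ C.V j),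
      ‖(⟨ContinuousLinearMap.adjoint D f, hx⟩ : C.V j)
        - π.map j ⟨ContinuousLinearMap.adjoint D f, hx⟩‖ ≤ π.normDK i * ‖f‖) ∧
      π.normDK i ≤ m * ‖D‖ := by
  subst h
  have hT : ∀ f : W i, ‖C.dNext i (C.K i f) - π.map (i + 1) (C.dNext i (C.K i f))‖
      ≤ m * ‖D‖ * ‖f‖ := by
    intro f
    refine (hstab _).trans ?_
    rw [mul_assoc]
    gcongr
    change ‖C.d i (i + 1) rfl (C.K i f)‖ ≤ _
    rw [d_K hC hD, ← (ContinuousLinearMap.adjoint (𝕜 := ℝ)).norm_map D]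
    exact ContinuousLinearMap.le_opNorm _ f
  refine ⟨fun f hx => ?_, operatorNorm_le (by positivity) hT⟩
  have h1 : (⟨ContinuousLinearMap.adjoint D f, hx⟩ : C.V (i + 1)) = C.dNext i (C.K i f) :=
    Subtype.ext (d_K hC hD f).symm
  rw [h1]
  exact le_operatorNorm_mul (by positivity) hT f

theorem normDStarK_bounds {i j : ℤ} {h : i + 1 = j} {G : W j →L[ℝ] W i}
    (hG : C.full.IsPseudoinverse i j h G)
    (hstab : ∀ v : C.V i, ‖v - π.map i v‖ ≤ m * ‖v‖) :
    (∀ (f : W j) (hx : G f ∈ C.V i),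
      ‖(⟨G f, hx⟩ : C.V i) - π.map i ⟨G f, hx⟩‖ ≤ π.normDStarK j * ‖f‖) ∧
      π.normDStarK j ≤ m * ‖G‖ := by
  obtain rfl : i = j - 1 := by omega
  have hT : ∀ f : W j, ‖C.dStarK j f - π.map (j - 1) (C.dStarK j f)‖ ≤ m * ‖G‖ * ‖f‖ := by
    intro f
    refine (hstab _).trans ?_
    rw [mul_assoc]
    gcongr
    rw [Submodule.coe_norm, coe_dStarK hC hG]
    exact G.le_opNorm f
  refine ⟨fun f hx => ?_, operatorNorm_le (by positivity) hT⟩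
  have h1 : (⟨G f, hx⟩ : C.V (j - 1)) = C.dStarK j f := Subtype.ext (coe_dStarK hC hG f).symm
  rw [h1]
  exact le_operatorNorm_mul (by positivity) hT f

/-- Over a coboundary `b`, the term `D D* b` of `K b` vanishes, so that `K b = G* G b`. -/
theorem delta_bounds {k : ℤ} {G : W k →L[ℝ] W (k - 1)} {D : W (k + 1) →L[ℝ] W k}
    (hG : C.full.IsPseudoinverse (k - 1) k (sub_add_cancel k 1) G)
    (hD : C.full.IsPseudoinverse k (k + 1) rfl D)
    (hstab : ∀ v : C.V k, ‖v - π.map k v‖ ≤ m * ‖v‖) :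
    (∀ b ∈ C.full.coboundaries k, ∀ hx : ContinuousLinearMap.adjoint G (G b) ∈ C.V k,
      ‖(⟨ContinuousLinearMap.adjoint G (G b), hx⟩ : C.V k)
        - π.map k ⟨ContinuousLinearMap.adjoint G (G b), hx⟩‖ ≤ π.delta k * ‖b‖) ∧
      π.delta k ≤ m * (‖G‖ * ‖G‖ + ‖D‖ * ‖D‖) := by
  have hT : ∀ f : W k, ‖C.K k f - π.map k (C.K k f)‖
      ≤ m * (‖G‖ * ‖G‖ + ‖D‖ * ‖D‖) * ‖f‖ := by
    intro f
    refine (hstab _).trans ?_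
    rw [mul_assoc]
    gcongr
    rw [Submodule.coe_norm, coe_K hC hG hD, add_mul]
    refine (norm_add_le _ _).trans (add_le_add ?_ ?_)
    · refine (ContinuousLinearMap.le_opNorm _ _).trans ?_
      rw [(ContinuousLinearMap.adjoint (𝕜 := ℝ)).norm_map G, mul_assoc]
      gcongr
      exact G.le_opNorm f
    · refine (D.le_opNorm _).trans ?_
      rw [mul_assoc, ← (ContinuousLinearMap.adjoint (𝕜 := ℝ)).norm_map D]
      gcongr
      exact ContinuousLinearMap.le_opNorm _ f
  refine ⟨fun b hb hx => ?_, operatorNorm_le (by positivity) hT⟩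
  have h1 : (⟨ContinuousLinearMap.adjoint G (G b), hx⟩ : C.V k) = C.K k b := by
    refine Subtype.ext ?_
    rw [coe_K hC hG hD, hD.adjoint_apply_eq_zero (C.full.coboundaries_le_cocycles k hb),
      map_zero, add_zero]
  rw [h1]
  exact le_operatorNorm_mul (by positivity) hT b

omit hC in
theorem mu_bounds {k : ℤ} (hstab : ∀ v : C.V k, ‖v - π.map k v‖ ≤ m * ‖v‖) :
    (∀ q : C.V k, (q : W k) ∈ C.full.harmonic k → ‖q - π.map k q‖ ≤ π.mu k * ‖q‖) ∧
      π.mu k ≤ m := by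
  have hT : ∀ f : W k, ‖C.projH k f - π.map k (C.projH k f)‖ ≤ m * ‖f‖ := by
    intro f
    refine (hstab _).trans ?_
    gcongr
    exact Submodule.norm_starProjection_apply_le _ f
  refine ⟨fun q hq => ?_, operatorNorm_le hm hT⟩
  have h1 : C.projH k q = q :=
    Subtype.ext (Submodule.starProjection_eq_self_iff.2 hq)
  have h2 := le_operatorNorm_mul hm hT (q : W k)
  rwa [h1] at h2

theorem projectionBounds {k : ℤ} {G : W k →L[ℝ] W (k - 1)} {D : W (k + 1) →L[ℝ] W k} {N : ℝ}
    (hG : C.full.IsPseudoinverse (k - 1) k (sub_add_cancel k 1) G)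
    (hD : C.full.IsPseudoinverse k (k + 1) rfl D) (hGN : ‖G‖ ≤ N) (hDN : ‖D‖ ≤ N)
    (hstab : ∀ i, k - 1 ≤ i → i ≤ k + 1 → ∀ v : C.V i, ‖v - π.map i v‖ ≤ m * ‖v‖) :
    ProjectionBounds π k G D m N (π.eta k) (π.delta k) (π.mu k) where
  closed := hC
  pinv_G := hG
  pinv_D := hD
  norm_G := hGN
  norm_D := hDN
  m_nonneg := hm
  η_nonneg := le_max_of_le_left (le_max_of_le_left operatorNorm_nonneg)
  δ_nonneg := operatorNorm_nonneg
  μ_nonneg := operatorNorm_nonneg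
  stable := hstab
  bound_G y hy :=
    ((π.normDStarK_bounds hC hm hG (hstab _ le_rfl (by omega))).1 y hy).trans
      (by gcongr; exact le_max_of_le_left (le_max_right _ _))
  bound_adjoint_G x hx :=
    ((π.normDK_bounds hC hm hG (hstab _ (by omega) (by omega))).1 x hx).trans
      (by gcongr; exact le_max_of_le_right (le_max_left _ _))
  bound_D y hy :=
    ((π.normDStarK_bounds hC hm hD (hstab _ (by omega) (by omega))).1 y hy).trans
      (by gcongr; exact le_max_of_le_right (le_max_right _ _))
  bound_K := (π.delta_bounds hC hm hG hD (hstab _ (by omega) (by omega))).1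
  bound_harmonic := (π.mu_bounds hm (hstab _ (by omega) (by omega))).1

theorem eta_le {k : ℤ} {G : W k →L[ℝ] W (k - 1)} {D : W (k + 1) →L[ℝ] W k} {N : ℝ}
    (hG : C.full.IsPseudoinverse (k - 1) k (sub_add_cancel k 1) G)
    (hD : C.full.IsPseudoinverse k (k + 1) rfl D) (hGN : ‖G‖ ≤ N) (hDN : ‖D‖ ≤ N)
    (hstab : ∀ i, k - 1 ≤ i → i ≤ k + 1 → ∀ v : C.V i, ‖v - π.map i v‖ ≤ m * ‖v‖) :
    π.eta k ≤ m * N := by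
  have hG' := mul_le_mul_of_nonneg_left hGN hm
  have hD' := mul_le_mul_of_nonneg_left hDN hm
  refine max_le (max_le ?_ ?_) (max_le ?_ ?_)
  · exact (π.normDK_bounds hC hm hD (hstab _ (by omega) (by omega))).2.trans hD'
  · exact (π.normDStarK_bounds hC hm hG (hstab _ le_rfl (by omega))).2.trans hG'
  · exact (π.normDK_bounds hC hm hG (hstab _ (by omega) (by omega))).2.trans hG'
  · exact (π.normDStarK_bounds hC hm hD (hstab _ (by omega) (by omega))).2.trans hD'

end CochainProjection

/-! ### Error estimates for the semilinear problem -/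

namespace ProjectionBounds

variable {π : S.CochainProjection} {k : ℤ} {G : W k →L[ℝ] W (k - 1)} {D : W (k + 1) →L[ℝ] W k}
  {m N η δ μ : ℝ} (A : ProjectionBounds π k G D m N η δ μ)

include A

/-- Stability of the discrete problem: the coboundary part of `u` is controlled by `σ`, the part
orthogonal to the cocycles by `d u`, and there is no harmonic part. -/
theorem norm_u_le {f : W k} {F : C.V k → W k} {σ : C.V (k - 1)} {u p : C.V k}
    (hs : S.IsMixedSolution k F f σ u p) :
    ‖u‖ ≤ (η + N) * (‖σ‖ + ‖C.d k (k + 1) rfl u‖) := by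
  have hν : 0 ≤ η + N := add_nonneg A.η_nonneg A.N_nonneg
  obtain ⟨v, hv, hv', huv, hdv⟩ := S.exists_orthogonal_cocycles (rfl : k + 1 = k + 1) hs.u_mem
  obtain ⟨b, hb, q, hq, hbq⟩ := S.exists_add_of_mem_cocycles
    (isClosed_coboundaries A.closed π k) huv
  have hvn := A.norm_le_of_mem_orthogonal_cocycles hv hv'
  rw [hdv] at hvn
  have hvb : ⟪(v : W k), b⟫_ℝ = 0 :=
    (Submodule.mem_orthogonal' _ _).1 hv' b (S.coboundaries_le_cocycles k hb)
  have hvq : ⟪(v : W k), q⟫_ℝ = 0 := (Submodule.mem_orthogonal' _ _).1 hv' q hq.1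
  have hbq0 : ⟪b, q⟫_ℝ = 0 := hq.2 _ hb
  have hu_eq : (u : W k) = b + q + v := by rw [← hbq, sub_add_cancel]
  have hq0 : q = 0 := by
    have h1 := hs.eq_three q hq
    rw [hu_eq, inner_add_left, inner_add_left, hbq0, hvq, zero_add, add_zero] at h1
    exact inner_self_eq_zero.1 h1
  have hbn : ‖b‖ ≤ (η + N) * ‖σ‖ := by
    refine le_of_sq_le_mul (by positivity) ?_
    obtain ⟨τ₀, hτ₀, hbτ₀⟩ := (S.mem_coboundaries_iff (sub_add_cancel k 1) b).1 hb
    obtain ⟨τ, hτ, hτ', -, hbτ⟩ := S.exists_orthogonal_cocycles (sub_add_cancel k 1) hτ₀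
    rw [hbτ₀] at hbτ
    have h1 : ‖b‖ ^ 2 = ⟪(σ : W (k - 1)), (τ : W (k - 1))⟫_ℝ := by
      rw [hs.inner_σ hτ, hbτ, hu_eq, hq0, inner_add_left, inner_add_left, hvb, inner_zero_left,
        real_inner_self_eq_norm_sq, add_zero, add_zero]
    have h2 := A.norm_le_of_mem_orthogonal_cocycles_pred hτ hτ'
    rw [hbτ] at h2
    rw [h1]
    calc _ ≤ ‖σ‖ * ‖(τ : W (k - 1))‖ := real_inner_le_norm _ _
      _ ≤ ‖σ‖ * ((η + N) * ‖b‖) := by gcongr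
      _ = _ := by ring
  have hfin : ‖u‖ ≤ ‖b‖ + ‖(v : W k)‖ := by
    rw [Submodule.coe_norm, hu_eq, hq0, add_zero]
    exact norm_add_le _ _
  linarith

variable {f : W k} {F : C.V k → W k} {L : ℝ} (hL : 0 ≤ L)
  (hmono : ∀ v v' : C.V k, 0 ≤ ⟪F v - F v', (v : W k) - (v' : W k)⟫_ℝ)
  (hlip : ∀ v v' : C.V k, ‖F v - F v'‖ ≤ L * C.normV (v - v'))
  {σ σ' σh : C.V (k - 1)} {u u' uh p p' ph : C.V k}

include hL hmono hlip

/-- The solution of the discrete semilinear problem is compared with the discrete solution of the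
linear problem with right-hand side `f - F (u + p)`. Their difference solves a discrete linear
problem with right-hand side `F (uh + ph) - F (u + p)`; by monotonicity, only the part
`F (u' + p') - F (u + p)` contributes to its energy. -/
theorem norm_sub_semilinear_le (hs : C.full.IsMixedSolution k F f σ u p)
    (hs' : S.IsMixedSolution k (fun _ => 0) (f - F (u + p)) σ' u' p')
    (hh : S.IsMixedSolution k F f σh uh ph) :
    ‖σ' - σh‖ + ‖C.d k (k + 1) rfl (u' - uh)‖ + ‖p' - ph‖
      ≤ 3 * (L * (η + N + 1)) * (‖u - u'‖ + ‖C.d k (k + 1) rfl (u - u')‖ + ‖p - p'‖) := by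
  have hη := A.η_nonneg
  have hN := A.N_nonneg
  set ε := ‖u - u'‖ + ‖C.d k (k + 1) rfl (u - u')‖ + ‖p - p'‖ with hε
  have hε0 : 0 ≤ ε := by positivity
  have hd := hs'.sub hh.toLinear
  rw [sub_sub_sub_cancel_left] at hd
  have hE := hd.energy
  have hu := A.norm_u_le hd
  have hm := hmono (u' + p') (uh + ph)
  have hg : ‖F (u' + p') - F (u + p)‖ ≤ L * ε := by
    refine (hlip _ _).trans (mul_le_mul_of_nonneg_left ((normV_le _).trans ?_) hL)
    have h1 : (u' + p') - (u + p) = -((u - u') + (p - p')) := by abel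
    have h2 : C.d k (k + 1) rfl ((u' + p') - (u + p)) = -C.d k (k + 1) rfl (u - u') := by
      rw [h1, map_neg, map_add, map_sub _ p, hs.dp_eq_zero, hs'.dp_eq_zero, sub_zero, add_zero]
    rw [h2, h1, norm_neg, norm_neg, hε]
    linarith [norm_add_le (u - u') (p - p')]
  set x : W k := ((u' - uh : C.V k) : W k) + ((p' - ph : C.V k) : W k) with hx
  have hxn : ‖x‖ ≤ ‖u' - uh‖ + ‖p' - ph‖ := norm_add_le _ _
  have hx' : ((u' + p' : C.V k) : W k) - ((uh + ph : C.V k) : W k) = x := by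
    simp only [hx, Submodule.coe_add, AddSubgroupClass.coe_sub]
    abel
  rw [hx'] at hm
  have h1 : ⟪F (uh + ph) - F (u + p), x⟫_ℝ ≤ L * ε * ‖x‖ := by
    have h2 : F (uh + ph) - F (u + p)
        = (F (u' + p') - F (u + p)) - (F (u' + p') - F (uh + ph)) := by abel
    rw [h2, inner_sub_left]
    have h3 := real_inner_le_norm (F (u' + p') - F (u + p)) x
    have h4 := mul_le_mul_of_nonneg_right hg (norm_nonneg x)
    linarith
  set s := ‖σ' - σh‖
  set a := ‖C.d k (k + 1) rfl (u' - uh)‖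
  set r := ‖p' - ph‖
  have hs0 : 0 ≤ s := norm_nonneg _
  have ha0 : 0 ≤ a := norm_nonneg _
  have hr0 : 0 ≤ r := norm_nonneg _
  have hE' : s ^ 2 + a ^ 2 + r ^ 2 ≤ L * ε * ‖x‖ := hE.trans_le h1
  have hx2 : ‖x‖ ≤ (η + N + 1) * (s + a + r) := by
    have h5 : 0 ≤ (η + N) * r := by positivity
    linarith
  refine le_of_sq_le_mul (by positivity) ?_
  have h6 : L * ε * ‖x‖ ≤ L * ε * ((η + N + 1) * (s + a + r)) := by gcongr
  nlinarith [sq_nonneg (s - a), sq_nonneg (s - r), sq_nonneg (a - r)]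

omit A hmono in
theorem norm_d_sub_semilinear_le (hs : C.full.IsMixedSolution k F f σ u p)
    (hs' : S.IsMixedSolution k (fun _ => 0) (f - F (u + p)) σ' u' p')
    (hh : S.IsMixedSolution k F f σh uh ph) :
    ‖C.d (k - 1) k (sub_add_cancel k 1) (σ' - σh)‖
      ≤ L * (‖u - uh‖ + ‖C.d k (k + 1) rfl (u - uh)‖ + ‖p - ph‖) := by
  have hd := hs'.sub hh.toLinear
  rw [sub_sub_sub_cancel_left] at hd
  refine hd.norm_dσ_le.trans ?_
  rw [norm_sub_rev]
  refine (hlip _ _).trans (mul_le_mul_of_nonneg_left ((normV_le _).trans ?_) hL)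
  have h1 : (u + p) - (uh + ph) = (u - uh) + (p - ph) := by abel
  have h2 : C.d k (k + 1) rfl ((u + p) - (uh + ph)) = C.d k (k + 1) rfl (u - uh) := by
    rw [h1, map_add, map_sub _ p, hs.dp_eq_zero, hh.dp_eq_zero, sub_zero, add_zero]
  rw [h2, h1]
  linarith [norm_add_le (u - uh) (p - ph)]

end ProjectionBounds

end Subcomplex

namespace Subcomplex

/-- The error of the linear mixed method in `u`, `d u` and `p`, with a constant that depends only
on the stability bounds and on an upper bound `κ` for `η`. -/
theorem exists_linear_error_const {k : ℤ} {m N κ : ℝ} (hm : 0 ≤ m) (hN : 0 ≤ N) (hκ : 0 ≤ κ) :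
    ∃ c : ℝ, 0 ≤ c ∧ ∀ {S : C.Subcomplex} {π : S.CochainProjection} {G : W k →L[ℝ] W (k - 1)}
      {D : W (k + 1) →L[ℝ] W k} {η δ μ : ℝ}, ProjectionBounds π k G D m N η δ μ → η ≤ κ →
      ∀ {g : W k} {σ σ' : C.V (k - 1)} {u u' p p' : C.V k},
      C.full.IsMixedSolution k (fun _ => 0) g σ u p →
      S.IsMixedSolution k (fun _ => 0) g σ' u' p' →
      ‖u - u'‖ + ‖C.d k (k + 1) rfl (u - u')‖ + ‖p - p'‖ ≤
        c * (S.bestError (u : W k) + S.bestError (C.d k (k + 1) rfl u) + S.bestError (p : W k)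
          + η * (S.bestError (σ : W (k - 1))
            + S.bestError (C.d (k - 1) k (sub_add_cancel k 1) σ))
          + (δ + μ) * S.bestError (C.d (k - 1) k (sub_add_cancel k 1) σ)
          + μ * S.bestError (C.projB k u)) := by
  refine ⟨2 * m + (2 * m + κ * (2 * m)) + (3 * m + (κ + N) * (m + (2 * m + κ * (2 * m)))
    + (m + 2 * κ * m) + m), by positivity, ?_⟩
  intro S π G D η δ μ A hηκ g σ σ' u u' p p' hs hs'
  have hη := A.η_nonneg
  have hδ := A.δ_nonneg
  have hμ := A.μ_nonneg
  have e1 := A.norm_dσ_sub_le hs hs'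
  have e2 := A.norm_σ_sub_le hs hs'
  have e3 := A.norm_p_sub_le hs hs'
  have e4 := A.norm_du_sub_le hs hs'
  have e5 := A.norm_u_sub_le hs hs'
  have hb := bestError_nonneg (S := S) (σ : W (k - 1))
  have ha := bestError_nonneg (S := S) (C.d (k - 1) k (sub_add_cancel k 1) σ)
  have hx := bestError_nonneg (S := S) (u : W k)
  have hy := bestError_nonneg (S := S) (C.d k (k + 1) rfl u)
  have hz := bestError_nonneg (S := S) (p : W k)
  have hw := bestError_nonneg (S := S) (C.projB k u)
  have p1 := norm_nonneg (C.d (k - 1) k (sub_add_cancel k 1) (σ - σ'))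
  have p3 := norm_nonneg (p - p')
  have p4 := norm_nonneg (C.d k (k + 1) rfl (u - u'))
  generalize ‖C.d (k - 1) k (sub_add_cancel k 1) (σ - σ')‖ = t1 at *
  generalize ‖σ - σ'‖ = t2 at *
  generalize ‖p - p'‖ = t3 at *
  generalize ‖C.d k (k + 1) rfl (u - u')‖ = t4 at *
  generalize ‖u - u'‖ = t5 at *
  generalize S.bestError (σ : W (k - 1)) = b at *
  generalize S.bestError (C.d (k - 1) k (sub_add_cancel k 1) σ) = a at *
  generalize S.bestError (u : W k) = x at *
  generalize S.bestError (C.d k (k + 1) rfl u) = y at *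
  generalize S.bestError (p : W k) = z at *
  generalize S.bestError (C.projB k u) = w at *
  set X := x + y + z + η * (b + a) + (δ + μ) * a + μ * w with hX
  have hηa : 0 ≤ η * a := by positivity
  have hηb : 0 ≤ η * b := by positivity
  have hδa : 0 ≤ δ * a := by positivity
  have hμa : 0 ≤ μ * a := by positivity
  have hμw : 0 ≤ μ * w := by positivity
  have hXe : X = x + y + z + η * b + η * a + δ * a + μ * a + μ * w := by rw [hX]; ring
  have hX0 : 0 ≤ X := by positivity
  have b3 : t3 ≤ 2 * m * X := by
    have h1 : m * (2 * z + μ * a) ≤ m * (2 * X) := by gcongr; linarith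
    linarith
  have b4 : t4 ≤ (2 * m + κ * (2 * m)) * X := by
    have h1 : m * (2 * y + η * a) ≤ m * (2 * X) := by gcongr; linarith
    have h2 : η * t1 ≤ η * (m * a) := by gcongr
    have h3 : η * t3 ≤ κ * (2 * m * X) := by gcongr
    linarith
  have b5 : t5 ≤ (3 * m + (κ + N) * (m + (2 * m + κ * (2 * m))) + (m + 2 * κ * m) + m) * X := by
    have h1 : m * (3 * x + μ * w) ≤ m * (3 * X) := by gcongr; linarith
    have h2 : (η + N) * (m * y + t4) ≤ (κ + N) * (m * X + (2 * m + κ * (2 * m)) * X) := by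
      gcongr
      linarith
    have h3 : η * t2 ≤ η * (m * b + 2 * κ * (m * a)) := by
      refine mul_le_mul_of_nonneg_left (e2.trans ?_) hη
      gcongr
    have h4 : m * (η * b) + 2 * κ * m * (η * a) ≤ m * X + 2 * κ * m * X := by
      gcongr <;> linarith
    have h5 : δ * t1 ≤ δ * (m * a) := by gcongr
    have h6 : m * (δ * a) ≤ m * X := by gcongr; linarith
    linarith
  linarith

/-- The error estimates for one subcomplex, with a constant that depends only on the stability
bounds, on the Lipschitz constant `L` of `F`, and on an upper bound `κ` for `η`, `δ` and `μ`. -/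
theorem exists_semilinear_error_const {k : ℤ} {F : C.V k → W k} {L m N κ : ℝ} (hL : 0 ≤ L)
    (hmono : ∀ v v' : C.V k, 0 ≤ ⟪F v - F v', (v : W k) - (v' : W k)⟫_ℝ)
    (hlip : ∀ v v' : C.V k, ‖F v - F v'‖ ≤ L * C.normV (v - v'))
    (hm : 0 ≤ m) (hN : 0 ≤ N) (hκ : 0 ≤ κ) :
    ∃ c : ℝ, ∀ {S : C.Subcomplex} {π : S.CochainProjection} {G : W k →L[ℝ] W (k - 1)}
      {D : W (k + 1) →L[ℝ] W k} {η δ μ : ℝ}, ProjectionBounds π k G D m N η δ μ →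
      η ≤ κ → δ ≤ κ → μ ≤ κ →
      ∀ {f : W k} {σ σh : C.V (k - 1)} {u uh p ph : C.V k},
      C.full.IsMixedSolution k F f σ u p → S.IsMixedSolution k F f σh uh ph →
      ‖C.d (k - 1) k (sub_add_cancel k 1) (σ - σh)‖ ≤
        c * (S.bestError (C.d (k - 1) k (sub_add_cancel k 1) σ) + S.bestError (u : W k)
          + S.bestError (C.d k (k + 1) rfl u) + S.bestError (p : W k)
          + η * S.bestError (σ : W (k - 1))
          + μ * S.bestError (C.projB k u)) ∧
      ‖σ - σh‖ ≤
        c * (S.bestError (σ : W (k - 1)) + S.bestError (u : W k)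
          + S.bestError (C.d k (k + 1) rfl u) + S.bestError (p : W k)
          + (η + δ + μ)
            * S.bestError (C.d (k - 1) k (sub_add_cancel k 1) σ)
          + μ * S.bestError (C.projB k u)) ∧
      C.normV (u - uh) + ‖p - ph‖ ≤
        c * (S.bestError (u : W k) + S.bestError (C.d k (k + 1) rfl u)
          + S.bestError (p : W k)
          + η * (S.bestError (σ : W (k - 1))
            + S.bestError (C.d (k - 1) k (sub_add_cancel k 1) σ))
          + (δ + μ)
            * S.bestError (C.d (k - 1) k (sub_add_cancel k 1) σ)
          + μ * S.bestError (C.projB k u)) := by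
  obtain ⟨c₁, hc₁, hlin⟩ :=
    exists_linear_error_const (C := C) (k := k) hm hN hκ
  set c₂ := 3 * (L * (κ + N + 1)) with hc₂def
  have hc₂ : 0 ≤ c₂ := by positivity
  set c₃ := (1 + (κ + N + 1) * c₂) * c₁ with hc₃def
  have hc₃ : 0 ≤ c₃ := by positivity
  refine ⟨(m + L * (c₃ * (1 + 3 * κ))) + (3 * m + c₂ * (c₁ * (1 + κ))) + c₃, ?_⟩
  intro S π G D η δ μ A hηκ hδκ hμκ f σ σh u uh p ph hs hh
  have hη := A.η_nonneg
  have hδ := A.δ_nonneg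
  have hμ := A.μ_nonneg
  -- the discrete solution of the linear problem with right-hand side `f - F (u + p)`
  obtain ⟨σ', u', p', hs'⟩ : ∃ (σ' : C.V (k - 1)) (u' p' : C.V k),
      S.IsMixedSolution k (fun _ => 0) (f - F (u + p)) σ' u' p' := by
    have hB := isClosed_coboundaries A.closed π
    obtain ⟨Gh, hGh⟩ := S.exists_isPseudoinverse (sub_add_cancel k 1) (hB k)
    obtain ⟨Dh, hDh⟩ := S.exists_isPseudoinverse (rfl : k + 1 = k + 1) (hB (k + 1))
    exact ⟨_, _, _, S.isMixedSolution_of_isPseudoinverse hGh hDh (hB k) _⟩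
  have hε := hlin A hηκ hs.toLinear hs'
  have e1 := A.norm_dσ_sub_le hs.toLinear hs'
  have e2 := A.norm_σ_sub_le hs.toLinear hs'
  have ht := A.norm_sub_semilinear_le hL hmono hlip hs hs' hh
  have hds := ProjectionBounds.norm_d_sub_semilinear_le hL hlip hs hs' hh
  have hue := A.norm_u_le (hs'.sub hh.toLinear)
  have q1 : ‖C.d (k - 1) k (sub_add_cancel k 1) (σ - σh)‖
      ≤ ‖C.d (k - 1) k (sub_add_cancel k 1) (σ - σ')‖
        + ‖C.d (k - 1) k (sub_add_cancel k 1) (σ' - σh)‖ := by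
    rw [← sub_add_sub_cancel σ σ' σh, map_add]
    exact norm_add_le _ _
  have q2 := norm_sub_le_norm_sub_add_norm_sub σ σ' σh
  have q3 := norm_sub_le_norm_sub_add_norm_sub u u' uh
  have q4 : ‖C.d k (k + 1) rfl (u - uh)‖
      ≤ ‖C.d k (k + 1) rfl (u - u')‖ + ‖C.d k (k + 1) rfl (u' - uh)‖ := by
    rw [← sub_add_sub_cancel u u' uh, map_add]
    exact norm_add_le _ _
  have q5 := norm_sub_le_norm_sub_add_norm_sub p p' ph
  have q6 := normV_le (u - uh)
  have ha := bestError_nonneg (S := S)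
    (C.d (k - 1) k (sub_add_cancel k 1) σ)
  have hb := bestError_nonneg (S := S) (σ : W (k - 1))
  have hx := bestError_nonneg (S := S) (u : W k)
  have hy := bestError_nonneg (S := S) (C.d k (k + 1) rfl u)
  have hz := bestError_nonneg (S := S) (p : W k)
  have hw := bestError_nonneg (S := S) (C.projB k u)
  have r1 := norm_nonneg (σ' - σh)
  have r2 := norm_nonneg (C.d k (k + 1) rfl (u' - uh))
  have r3 := norm_nonneg (p' - ph)
  have hε0 : 0 ≤ ‖u - u'‖ + ‖C.d k (k + 1) rfl (u - u')‖ + ‖p - p'‖ := by positivity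
  generalize S.bestError (C.d (k - 1) k (sub_add_cancel k 1) σ) = a at *
  generalize S.bestError (σ : W (k - 1)) = b at *
  generalize S.bestError (u : W k) = x at *
  generalize S.bestError (C.d k (k + 1) rfl u) = y at *
  generalize S.bestError (p : W k) = z at *
  generalize S.bestError (C.projB k u) = w at *
  set ε := ‖u - u'‖ + ‖C.d k (k + 1) rfl (u - u')‖ + ‖p - p'‖ with hεdef
  set t := ‖σ' - σh‖ + ‖C.d k (k + 1) rfl (u' - uh)‖ + ‖p' - ph‖ with htdef
  set Q := ‖u - uh‖ + ‖C.d k (k + 1) rfl (u - uh)‖ + ‖p - ph‖ with hQdef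
  set X₁ := a + x + y + z + η * b + μ * w with hX₁
  set X₂ := b + x + y + z + (η + δ + μ) * a + μ * w with hX₂
  set X₃ := x + y + z + η * (b + a) + (δ + μ) * a + μ * w with hX₃
  have hηa : 0 ≤ η * a := by positivity
  have hηb : 0 ≤ η * b := by positivity
  have hδa : 0 ≤ δ * a := by positivity
  have hμa : 0 ≤ μ * a := by positivity
  have hμw : 0 ≤ μ * w := by positivity
  have hX₁0 : 0 ≤ X₁ := by positivity
  have hX₂0 : 0 ≤ X₂ := by positivity
  have hX₃0 : 0 ≤ X₃ := by positivity
  have ht' : t ≤ c₂ * ε := by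
    refine ht.trans ?_
    rw [hc₂def]
    gcongr
  have hQ : Q ≤ c₃ * X₃ := by
    have h1 : (η + N) * (‖σ' - σh‖ + ‖C.d k (k + 1) rfl (u' - uh)‖) ≤ (κ + N) * t := by
      gcongr
      linarith
    have h2 : (κ + N + 1) * t ≤ (κ + N + 1) * (c₂ * ε) := by gcongr
    have h3 : (1 + (κ + N + 1) * c₂) * ε ≤ (1 + (κ + N + 1) * c₂) * (c₁ * X₃) := by gcongr
    rw [hc₃def]
    linarith
  have hX₃₁ : X₃ ≤ (1 + 3 * κ) * X₁ := by
    have h1 : η * a ≤ κ * a := by gcongr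
    have h2 : δ * a ≤ κ * a := by gcongr
    have h3 : μ * a ≤ κ * a := by gcongr
    have h4 : 3 * κ * a ≤ 3 * κ * X₁ := by gcongr; linarith
    linarith
  have hX₃₂ : X₃ ≤ (1 + κ) * X₂ := by
    have h1 : η * b ≤ κ * b := by gcongr
    have h2 : κ * b ≤ κ * X₂ := by gcongr; linarith
    linarith
  -- the three constants are added up to a single one
  have hsum : ∀ {d₁ d₂ d₃ Y : ℝ}, 0 ≤ d₁ → 0 ≤ d₂ → 0 ≤ d₃ → 0 ≤ Y →
      d₁ * Y ≤ (d₁ + d₂ + d₃) * Y ∧ d₂ * Y ≤ (d₁ + d₂ + d₃) * Y ∧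
        d₃ * Y ≤ (d₁ + d₂ + d₃) * Y := fun h₁ h₂ h₃ hY =>
    ⟨by gcongr; linarith, by gcongr; linarith, by gcongr; linarith⟩
  have hd₁ : 0 ≤ m + L * (c₃ * (1 + 3 * κ)) := by positivity
  have hd₂ : 0 ≤ 3 * m + c₂ * (c₁ * (1 + κ)) := by positivity
  refine ⟨le_trans ?_ (hsum hd₁ hd₂ hc₃ hX₁0).1, le_trans ?_ (hsum hd₁ hd₂ hc₃ hX₂0).2.1,
    le_trans ?_ (hsum hd₁ hd₂ hc₃ hX₃0).2.2⟩
  · have h1 : L * Q ≤ L * (c₃ * ((1 + 3 * κ) * X₁)) := by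
      gcongr
      exact hQ.trans (by gcongr)
    have h2 : m * a ≤ m * X₁ := by gcongr; linarith
    linarith
  · have h1 : c₂ * ε ≤ c₂ * (c₁ * ((1 + κ) * X₂)) := by
      gcongr
      exact hε.trans (by gcongr)
    have h2 : m * (b + 2 * (η * a)) ≤ m * (3 * X₂) := by gcongr; linarith
    have h3 : η * ‖C.d (k - 1) k (sub_add_cancel k 1) (σ - σ')‖ ≤ η * (m * a) := by gcongr
    linarith
  · linarith

end Subcomplex

end HilbertComplex

theorem mainTheorem4 {W : ℤ → Type*} [∀ k, NormedAddCommGroup (W k)]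
    [∀ k, InnerProductSpace ℝ (W k)] [∀ k, CompleteSpace (W k)]
    (C : HilbertComplex W) (hclosed : C.IsClosedComplex) (hcompact : C.CompactnessProperty)
    -- a family of subcomplexes with cochain projections that are uniformly `W`-bounded
    {ι : Type*} (S : ι → C.Subcomplex) (π : ∀ h, (S h).CochainProjection)
    (hπ : ∀ k, ∃ M : ℝ, ∀ (h : ι) (v : C.V k), ‖(π h).map k v‖ ≤ M * ‖v‖)
    (k : ℤ) (F : C.V k → W k)
    -- `F` is monotone, and Lipschitz with respect to the `V`-norm
    (hmono : ∀ v v' : C.V k, 0 ≤ ⟪F v - F v', (v : W k) - (v' : W k)⟫_ℝ)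
    (hlip : ∃ L : ℝ, ∀ v v' : C.V k, ‖F v - F v'‖ ≤ L * C.normV (v - v')) :
    ∃ c : ℝ, ∀ (h : ι) (f : W k)
      (σ : C.V (k - 1)) (u p : C.V k) (σh : C.V (k - 1)) (uh ph : C.V k),
      C.full.IsMixedSolution k F f σ u p →
      (S h).IsMixedSolution k F f σh uh ph →
      ‖C.dPrev k (σ - σh)‖ ≤
        c * ((S h).bestError (C.dPrev k σ : W k) + (S h).bestError (u : W k)
          + (S h).bestError (C.dNext k u : W (k + 1)) + (S h).bestError (p : W k)
          + (π h).eta k * (S h).bestError (σ : W (k - 1))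
          + (π h).mu k * (S h).bestError (C.projB k u)) ∧
      ‖σ - σh‖ ≤
        c * ((S h).bestError (σ : W (k - 1)) + (S h).bestError (u : W k)
          + (S h).bestError (C.dNext k u : W (k + 1)) + (S h).bestError (p : W k)
          + ((π h).eta k + (π h).delta k + (π h).mu k) * (S h).bestError (C.dPrev k σ : W k)
          + (π h).mu k * (S h).bestError (C.projB k u)) ∧
      C.normV (u - uh) + ‖p - ph‖ ≤
        c * ((S h).bestError (u : W k) + (S h).bestError (C.dNext k u : W (k + 1))
          + (S h).bestError (p : W k)
          + (π h).eta k * ((S h).bestError (σ : W (k - 1))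
            + (S h).bestError (C.dPrev k σ : W k))
          + ((π h).delta k + (π h).mu k) * (S h).bestError (C.dPrev k σ : W k)
          + (π h).mu k * (S h).bestError (C.projB k u)) := by
  obtain ⟨G, hG⟩ := C.full.exists_isPseudoinverse (sub_add_cancel k 1)
    (HilbertComplex.Subcomplex.isClosed_coboundaries_full hclosed k)
  obtain ⟨D, hD⟩ := C.full.exists_isPseudoinverse (rfl : k + 1 = k + 1)
    (HilbertComplex.Subcomplex.isClosed_coboundaries_full hclosed (k + 1))
  set N := max ‖G‖ ‖D‖ with hNdef
  have hN : 0 ≤ N := le_max_of_le_left (norm_nonneg G)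
  obtain ⟨L, hL, hlip⟩ : ∃ L : ℝ, 0 ≤ L ∧ ∀ v v' : C.V k, ‖F v - F v'‖ ≤ L * C.normV (v - v') := by
    obtain ⟨L, hL⟩ := hlip
    exact ⟨max L 0, le_max_right _ _, fun v v' => (hL v v').trans
      (mul_le_mul_of_nonneg_right (le_max_left _ _) (Real.sqrt_nonneg _))⟩
  obtain ⟨m, hm, hstab⟩ : ∃ m : ℝ, 0 ≤ m ∧ ∀ (h : ι) (i : ℤ), k - 1 ≤ i → i ≤ k + 1 →
      ∀ v : C.V i, ‖v - (π h).map i v‖ ≤ m * ‖v‖ := by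
    choose M hM using hπ
    refine ⟨1 + (|M (k - 1)| + |M k| + |M (k + 1)|), by positivity, fun h i hi hi' v => ?_⟩
    have h1 : M i ≤ |M (k - 1)| + |M k| + |M (k + 1)| := by
      have h0 := abs_nonneg (M (k - 1))
      have h0' := abs_nonneg (M k)
      have h0'' := abs_nonneg (M (k + 1))
      have hi3 : i = k - 1 ∨ i = k ∨ i = k + 1 := by omega
      rcases hi3 with h | h | h <;> rw [h] <;> linarith [le_abs_self (M (k - 1)), le_abs_self (M k),
        le_abs_self (M (k + 1))]
    have h2 := mul_le_mul_of_nonneg_right h1 (norm_nonneg v)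
    linarith [norm_sub_le v ((π h).map i v), hM i h v]
  set κ := m * N + m * (N * N + N * N) + m with hκdef
  have hκ : 0 ≤ κ := by positivity
  obtain ⟨c, hc⟩ := HilbertComplex.Subcomplex.exists_semilinear_error_const hL hmono hlip hm hN hκ
  refine ⟨c, ?_⟩
  intro h f σ u p σh uh ph hs hh
  have A := (π h).projectionBounds hclosed hm hG hD (le_max_left _ _ : ‖G‖ ≤ N)
    (le_max_right _ _) (hstab h)
  -- `η`, `δ` and `μ` are bounded independently of `h`
  have hηκ : (π h).eta k ≤ κ := by
    have h1 := (π h).eta_le hclosed hm hG hD (le_max_left _ _ : ‖G‖ ≤ N) (le_max_right _ _)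
      (hstab h)
    have h2 : 0 ≤ m * (N * N + N * N) := by positivity
    linarith
  have hδκ : (π h).delta k ≤ κ := by
    have h1 := ((π h).delta_bounds hclosed hm hG hD (hstab h k (by omega) (by omega))).2
    have h2 : m * (‖G‖ * ‖G‖ + ‖D‖ * ‖D‖) ≤ m * (N * N + N * N) := by
      have hGN : ‖G‖ ≤ N := le_max_left _ _
      have hDN : ‖D‖ ≤ N := le_max_right _ _
      gcongr
    have h3 : 0 ≤ m * N := by positivity
    linarith
  have hμκ : (π h).mu k ≤ κ := by
    have h1 := ((π h).mu_bounds hm (hstab h k (by omega) (by omega))).2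
    have h2 : 0 ≤ m * (N * N + N * N) := by positivity
    have h3 : 0 ≤ m * N := by positivity
    linarith
  exact hc A hηκ hδκ hμκ hs hh
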